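/- Let $a>0$, $\lambda>0$ and $3<p\le 4$. For $u\in H^1(\mathbb{R}^3)$ (real-valued, with $\|u\|^2=\int|\nabla u|^2+\int u^2$) put $u^+=\max(u,0)$, $\phi_u(x)=\frac1{4\pi}\int_{\mathbb{R}^3}\frac{u^2(y)}{|x-y|}\,dy$ and $$I_a(u)=\frac12\int|\nabla u|^2+\frac a2\int u^2+\frac14\int\phi_u u^2-\frac\lambda p\int (u^+)^p-\frac16\int (u^+)^6,$$ $$P_a(u)=\frac12\int|\nabla u|^2+\frac{3a}2\int u^2+\frac54\int\phi_u u^2-\frac{3\lambda}p\int (u^+)^p-\frac12\int (u^+)^6,$$ $$G_a(u)=\frac32\int|\nabla u|^2+\frac a2\int u^2+\frac34\int\phi_u u^2-\frac{(2p-3)\lambda}p\int (u^+)^p-\frac32\int (u^+)^6,$$ all integrals being over $\mathbb{R}^3$. Let $\Gamma_a=\{\gamma\in C([0,1],H^1(\mathbb{R}^3)):\gamma(0)=0,\ I_a(\gamma(1))<0\}$ and $c_a=\inf_{\gamma\in\Gamma_a}\sup_{t\in[0,1]}I_a(\gamma(t))$. Then $I_a\in C^1(H^1(\mathbb{R}^3),\mathbb{R})$,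 $G_a(u)=2\langle I_a'(u),u\rangle-P_a(u)$ for all $u\in H^1(\mathbb{R}^3)$, $\Gamma_a\neq\emptyset$ and $c_a>0$. Moreover, there is a sequence $(u_n)$ in $H^1(\mathbb{R}^3)$ such that, as $n\to\infty$, $$I_a(u_n)\to c_a,\qquad I_a'(u_n)\to 0\ \text{ in } (H^1(\mathbb{R}^3))^{*},\qquad G_a(u_n)\to 0,$$ and every sequence in $H^1(\mathbb{R}^3)$ with these three properties is bounded in $H^1(\mathbb{R}^3)$. -/

import Mathlib

open MeasureTheory Filter Topology
open scoped ContDiff ENNReal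

noncomputable section

namespace SchrodingerPoisson

/-- Euclidean space `ℝ³`. -/
abbrev R3 : Type := EuclideanSpace ℝ (Fin 3)

/-- `g` is the weak gradient of `u` on `ℝ³`: for every test function `φ ∈ C_c^∞(ℝ³)` and every
direction `v`, `∫ u ∂_v φ = - ∫ (g · v) φ`. -/
def IsWeakGradient (u : R3 → ℝ) (g : R3 → R3) : Prop :=
  ∀ φ : R3 → ℝ, ContDiff ℝ ∞ φ → HasCompactSupport φ → ∀ v : R3,
    ∫ x, u x * fderiv ℝ φ x v = - ∫ x, inner ℝ (g x) v * φ x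

/-- The Hilbert space `L²(ℝ³) × L²(ℝ³; ℝ³)`, with `‖(u, g)‖² = ‖u‖² + ‖g‖²`. -/
abbrev L2Pair : Type :=
  WithLp 2 (Lp ℝ 2 (volume : Measure R3) × Lp R3 2 (volume : Measure R3))

theorem memLp_fderiv_apply {φ : R3 → ℝ} (h : ContDiff ℝ ∞ φ) (hc : HasCompactSupport φ)
    (v : R3) : MemLp (fun x => fderiv ℝ φ x v) 2 (volume : Measure R3) :=
  ((h.continuous_fderiv (by simp)).clm_apply continuous_const).memLp_of_hasCompactSupport
    (hc.fderiv_apply (𝕜 := ℝ) v)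

theorem integrable_left (u : Lp ℝ 2 (volume : Measure R3)) {φ : R3 → ℝ} (h : ContDiff ℝ ∞ φ)
    (hc : HasCompactSupport φ) (v : R3) :
    Integrable (fun x => u x * fderiv ℝ φ x v) (volume : Measure R3) :=
  MemLp.integrable_mul (p := 2) (q := 2) (Lp.memLp u) (memLp_fderiv_apply h hc v)

theorem integrable_right (g : Lp R3 2 (volume : Measure R3)) {φ : R3 → ℝ} (h : ContDiff ℝ ∞ φ)
    (hc : HasCompactSupport φ) (v : R3) :
    Integrable (fun x => inner ℝ (g x) v * φ x) (volume : Measure R3) :=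
  MemLp.integrable_mul (p := 2) (q := 2) ((Lp.memLp g).inner_const v)
    (h.continuous.memLp_of_hasCompactSupport hc)

/-- The real Sobolev space `H¹(ℝ³)`, realised as the subspace of all pairs `(u, ∇u)` with
`u ∈ L²` having a weak gradient `∇u ∈ L²`. As a subspace it carries the usual norm
`‖u‖² = ∫ |∇u|² + ∫ u²`. -/
def sobolevH1 : Submodule ℝ L2Pair where
  carrier := {w | IsWeakGradient w.fst w.snd}
  zero_mem' := by
    intro φ h hc v
    have h1 : ∫ x, ((0 : L2Pair).fst : R3 → ℝ) x * fderiv ℝ φ x v = 0 := by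
      apply integral_eq_zero_of_ae
      filter_upwards with x
      simp
    have h2 : ∫ x, inner ℝ (((0 : L2Pair).snd : R3 → R3) x) v * φ x = 0 := by
      apply integral_eq_zero_of_ae
      filter_upwards with x
      simp
    rw [h1, h2, neg_zero]
  add_mem' := by
    intro w z hw hz φ h hc v
    have h1 : ∫ x, ((w + z).fst : R3 → ℝ) x * fderiv ℝ φ x v
        = ∫ x, (w.fst x * fderiv ℝ φ x v + z.fst x * fderiv ℝ φ x v) := by
      apply integral_congr_ae
      filter_upwards [Lp.coeFn_add w.fst z.fst] with x hx
      simp only [WithLp.add_fst, hx, Pi.add_apply, add_mul]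
    have h2 : ∫ x, inner ℝ (((w + z).snd : R3 → R3) x) v * φ x
        = ∫ x, (inner ℝ (w.snd x) v * φ x + inner ℝ (z.snd x) v * φ x) := by
      apply integral_congr_ae
      filter_upwards [Lp.coeFn_add w.snd z.snd] with x hx
      simp only [WithLp.add_snd, hx, Pi.add_apply, inner_add_left, add_mul]
    rw [h1, h2, integral_add (integrable_left _ h hc v) (integrable_left _ h hc v),
      integral_add (integrable_right _ h hc v) (integrable_right _ h hc v),
      hw φ h hc v, hz φ h hc v]
    ring
  smul_mem' := by
    intro c w hw φ h hc v
    have h1 : ∫ x, ((c • w).fst : R3 → ℝ) x * fderiv ℝ φ x v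
        = ∫ x, c * (w.fst x * fderiv ℝ φ x v) := by
      apply integral_congr_ae
      filter_upwards [Lp.coeFn_smul c w.fst] with x hx
      simp [hx, mul_assoc]
    have h2 : ∫ x, inner ℝ (((c • w).snd : R3 → R3) x) v * φ x
        = ∫ x, c * (inner ℝ (w.snd x) v * φ x) := by
      apply integral_congr_ae
      filter_upwards [Lp.coeFn_smul c w.snd] with x hx
      simp only [WithLp.smul_snd, hx, Pi.smul_apply, real_inner_smul_left, mul_assoc]
    rw [h1, h2, integral_const_mul, integral_const_mul, hw φ h hc v, mul_neg]

/-- `H¹(ℝ³)` as a normed space. -/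
abbrev H1 : Type := sobolevH1

/-- The function underlying an element of `H¹(ℝ³)`. -/
def H1.val (u : H1) : R3 → ℝ := u.1.fst

/-- The weak gradient of an element of `H¹(ℝ³)`. -/
def H1.grad (u : H1) : R3 → R3 := u.1.snd

/-- The Newton potential `φ_u(x) = (1 / 4π) ∫ u(y)² / |x - y| dy`, the solution of
`-Δ φ_u = u²`. -/
def poissonPotential (u : H1) (x : R3) : ℝ :=
  1 / (4 * Real.pi) * ∫ y, u.val y ^ 2 / ‖x - y‖

/-- `∫ |∇u|²`. -/
def gradTerm (u : H1) : ℝ := ∫ x, ‖u.grad x‖ ^ 2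

/-- `∫ u²`. -/
def massTerm (u : H1) : ℝ := ∫ x, u.val x ^ 2

/-- `∫ φ_u u²`. -/
def poissonTerm (u : H1) : ℝ := ∫ x, poissonPotential u x * u.val x ^ 2

/-- `∫ (u⁺)^q`. -/
def posPowTerm (q : ℝ) (u : H1) : ℝ := ∫ x, (max (u.val x) 0) ^ q

/-- The energy functional `I_a` (with coupling `lam = λ` and exponent `p`). -/
def energy (a lam p : ℝ) (u : H1) : ℝ :=
  1 / 2 * gradTerm u + a / 2 * massTerm u + 1 / 4 * poissonTerm u
    - lam / p * posPowTerm p u - 1 / 6 * posPowTerm 6 u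

/-- The Pohozaev functional `P_a`. -/
def pohozaev (a lam p : ℝ) (u : H1) : ℝ :=
  1 / 2 * gradTerm u + 3 / 2 * a * massTerm u + 5 / 4 * poissonTerm u
    - 3 / p * lam * posPowTerm p u - 1 / 2 * posPowTerm 6 u

/-- The functional `G_a = 2 ⟨I_a'(u), u⟩ - P_a(u)`, in explicit form. -/
def nehariPohozaev (a lam p : ℝ) (u : H1) : ℝ :=
  3 / 2 * gradTerm u + 1 / 2 * a * massTerm u + 3 / 4 * poissonTerm u
    - (2 * p - 3) / p * lam * posPowTerm p u - 3 / 2 * posPowTerm 6 u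

/-- The class `Γ_a` of continuous paths `γ : [0,1] → H¹` with `γ(0) = 0` and `I_a(γ(1)) < 0`. -/
def paths (a lam p : ℝ) : Set C(unitInterval, H1) :=
  {γ | γ 0 = 0 ∧ energy a lam p (γ 1) < 0}

/-- The mountain pass level `c_a = inf_{γ ∈ Γ_a} sup_{t ∈ [0,1]} I_a(γ(t))`. -/
def mountainPassLevel (a lam p : ℝ) : ℝ :=
  ⨅ γ : paths a lam p, ⨆ t : unitInterval, energy a lam p (γ.1 t)

/-- `I_a(u_n) → c_a`, `I_a'(u_n) → 0` in the dual of `H¹`, and `G_a(u_n) → 0`; the derivative is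
the Fréchet derivative of `I_a` on `H¹`. -/
def IsPohozaevPalaisSmale (a lam p : ℝ) (u : ℕ → H1) : Prop :=
  Tendsto (fun n => energy a lam p (u n)) atTop (𝓝 (mountainPassLevel a lam p)) ∧
  Tendsto (fun n => fderiv ℝ (energy a lam p) (u n)) atTop (𝓝 0) ∧
  Tendsto (fun n => nehariPohozaev a lam p (u n)) atTop (𝓝 0)

end SchrodingerPoisson

end

open SchrodingerPoisson

/-! The mountain pass theorem alone gives almost critical points at level `c_a`, but not `G_a(u_n) →
0`. The extra condition comes from the scaling `u ↦ e^{2θ} u(e^θ ·)`. Under it the gradient and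
Poisson terms scale like `e^{3θ}`, the mass term like `e^θ`, the `q`-power term like `e^{(2q-3)θ}`,
and the `θ`-derivative of the energy is exactly `G_a`. The minimax argument is therefore run for
`dilatedEnergy` on the Hilbert space `ℝ × H¹`. Any path there is mapped by `dilation` to a path in
`H¹`, so a path starting on the slice `θ = 0` and ending there at the endpoints of a path of `Γ_a`
must still reach level `c_a`. An almost critical point `(θ, u)` found near that slice gives
`dilation θ u`: its `θ`-derivative is `G_a`, and its `u`-derivative is `I_a'` composed with a
dilation, whose norm is controlled since `θ` is small.

The minimax input is `exists_almost_critical_near_path`, obtained from Ekeland's principle on the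
complete space of paths with fixed endpoints together with a steepest descent deformation. The
analytic input is the embedding `H¹ ⊂ L⁶`, proved by mollifying and truncating. It makes the
critical power term `C¹` through pointwise Taylor bounds with weight `1 + u⁴`, and makes the Poisson
term a bounded quadrilinear form, since the Newton kernel is locally in `L^{3/2}`.

Boundedness follows from `I_a - G_a / (2p - 3)`, in which the `p`-power term cancels. For `3 < p ≤
4` the remaining terms have nonnegative coefficients, strictly positive on the gradient and mass
terms (`bounded_of_tendsto`). -/

/-! ### Abstract minimax theory on paths. -/

/-- Ekeland's variational principle. -/
theorem ekeland {X : Type*} [MetricSpace X] [CompleteSpace X] {f : X → ℝ}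
    (hf : LowerSemicontinuous f) {m : ℝ} (hm : ∀ x, m ≤ f x) {ε : ℝ} (hε : 0 < ε) (x₀ : X) :
    ∃ x, f x + ε * dist x₀ x ≤ f x₀ ∧ ∀ y, f x ≤ f y + ε * dist x y := by
  have hclosed : ∀ x c, IsClosed {y | f y + ε * dist x y ≤ c} := by
    intro x c
    have : LowerSemicontinuous fun y => f y + ε * dist x y :=
      hf.add (Continuous.lowerSemicontinuous (by fun_prop))
    exact this.isClosed_preimage c
  have hstep : ∀ (x : X) (δ : ℝ), 0 < δ → ∃ x', f x' + ε * dist x x' ≤ f x ∧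
      ∀ y, f y + ε * dist x y ≤ f x → f x' ≤ f y + δ := by
    intro x δ hδ
    set S := f '' {y | f y + ε * dist x y ≤ f x} with hS
    have hne : S.Nonempty := ⟨f x, x, by simp, rfl⟩
    have hbdd : BddBelow S := ⟨m, by rintro _ ⟨y, -, rfl⟩; exact hm y⟩
    obtain ⟨_, ⟨x', hx', rfl⟩, hlt⟩ := exists_lt_of_csInf_lt hne (lt_add_of_pos_right (sInf S) hδ)
    refine ⟨x', hx', fun y hy => ?_⟩
    have := csInf_le hbdd ⟨y, hy, rfl⟩
    linarith
  -- Each new point minimizes `f`, up to `2⁻ⁿ`, over the slice `{y | f y + ε d(x, y) ≤ f x}`. Slices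
  -- are nested by the triangle inequality, and near-minimality makes their radii shrink like `2⁻ⁿ /
  -- ε`.
  choose F hF1 hF2 using fun (x : X) (n : ℕ) => hstep x ((1 / 2 : ℝ) ^ n) (by positivity)
  let s : ℕ → X := fun n => Nat.rec x₀ (fun k x => F x k) n
  have hs0 : s 0 = x₀ := rfl
  have hs : ∀ n, s (n + 1) = F (s n) n := fun n => rfl
  have htrans : ∀ x y z : X, f y + ε * dist x y ≤ f x → f z + ε * dist y z ≤ f y →
      f z + ε * dist x z ≤ f x := by
    intro x y z h1 h2
    nlinarith [dist_triangle x y z]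
  have hmono : ∀ n k, f (s (n + k)) + ε * dist (s n) (s (n + k)) ≤ f (s n) := by
    intro n k
    induction k with
    | zero => simp
    | succ k ih => exact htrans _ _ _ ih (by rw [← add_assoc, hs]; exact hF1 _ _)
  have hsmall : ∀ n y, f y + ε * dist (s (n + 1)) y ≤ f (s (n + 1)) →
      dist (s (n + 1)) y ≤ (1 / 2 : ℝ) ^ n / ε := by
    intro n y hy
    have h1 : f y + ε * dist (s n) y ≤ f (s n) := htrans _ _ _ (hmono n 1) hy
    have h2 := hF2 (s n) n y h1
    rw [← hs] at h2
    rw [le_div_iff₀ hε]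
    linarith
  have hlim0 : Tendsto (fun n : ℕ => (1 / 2 : ℝ) ^ n / ε) atTop (𝓝 0) := by
    simpa using (tendsto_pow_atTop_nhds_zero_of_lt_one (by norm_num : (0 : ℝ) ≤ 1 / 2)
      (by norm_num)).div_const ε
  have hcau : CauchySeq fun n => s (n + 1) := by
    refine cauchySeq_of_le_tendsto_0' (fun n => (1 / 2 : ℝ) ^ n / ε) (fun n k hnk => ?_) hlim0
    obtain ⟨j, rfl⟩ := Nat.exists_eq_add_of_le hnk
    have := hmono (n + 1) j
    rw [show n + 1 + j = n + j + 1 by ring] at this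
    exact hsmall n _ this
  obtain ⟨x, hx⟩ := cauchySeq_tendsto_of_complete hcau
  have hxs : Tendsto s atTop (𝓝 x) := (tendsto_add_atTop_iff_nat 1).1 hx
  have hxS : ∀ n, f x + ε * dist (s n) x ≤ f (s n) := by
    intro n
    refine (hclosed (s n) (f (s n))).mem_of_tendsto hxs ?_
    filter_upwards [eventually_ge_atTop n] with k hk
    obtain ⟨j, rfl⟩ := Nat.exists_eq_add_of_le hk
    exact hmono n j
  refine ⟨x, hxS 0, fun y => ?_⟩
  -- A violating `y` would lie in every slice, so the sequence would converge to `y` as well as to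
  -- `x`.
  by_contra! hlt
  have h1 : ∀ n, dist (s (n + 1)) y ≤ (1 / 2 : ℝ) ^ n / ε := fun n =>
    hsmall n y (htrans _ _ _ (hxS (n + 1)) hlt.le)
  have h2 : Tendsto (fun n => s (n + 1)) atTop (𝓝 y) := by
    rw [tendsto_iff_dist_tendsto_zero]
    exact squeeze_zero (fun _ => dist_nonneg) h1 hlim0
  have : x = y := tendsto_nhds_unique hx h2
  subst this
  simp at hlt

section Minimax

variable {X : Type*} [NormedAddCommGroup X] [InnerProductSpace ℝ X] [CompleteSpace X]

/-- On a path at which the maximum of `Φ` cannot decrease at a rate faster than `ε` by a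
perturbation fixing the endpoints, some maximum point has a small derivative. -/
theorem exists_fderiv_le_of_path_almost_minimal {Φ : X → ℝ} (hΦ : ContDiff ℝ 1 Φ)
    {ε : ℝ} (hε : 0 < ε) (γ : C(unitInterval, X)) {M : ℝ} (hM : IsGreatest (Set.range (Φ ∘ γ)) M)
    (h0 : Φ (γ 0) < M) (h1 : Φ (γ 1) < M)
    (hmin : ∀ η : C(unitInterval, X), η 0 = γ 0 → η 1 = γ 1 →
      ∃ t, M ≤ Φ (η t) + ε * ‖η - γ‖) :
    ∃ t, Φ (γ t) = M ∧ ‖fderiv ℝ Φ (γ t)‖ ≤ ε := by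
  by_contra! hcon
  have hΦc : Continuous Φ := hΦ.continuous
  have hd : Differentiable ℝ Φ := hΦ.differentiable one_ne_zero
  have hDc : Continuous (fderiv ℝ Φ) := hΦ.continuous_fderiv one_ne_zero
  have hle : ∀ t, Φ (γ t) ≤ M := fun t => hM.2 ⟨t, rfl⟩
  set m := max (Φ (γ 0)) (Φ (γ 1)) with hm
  have hmM : m < M := max_lt h0 h1
  -- In a Hilbert space the Riesz representative is a continuous gradient field along the path, so
  -- no pseudo-gradient is needed.
  let g : unitInterval → X := fun t => (InnerProductSpace.toDual ℝ X).symm (fderiv ℝ Φ (γ t))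
  have hg : Continuous g := by
    exact (InnerProductSpace.toDual ℝ X).symm.continuous.comp (hDc.comp γ.continuous)
  have hgn : ∀ t, ‖g t‖ = ‖fderiv ℝ Φ (γ t)‖ := fun t => by simp [g]
  have hgi : ∀ t v, fderiv ℝ Φ (γ t) v = inner ℝ (g t) v := fun t v => by simp [g]
  -- A cutoff that vanishes where `Φ ≤ m`, in particular at both endpoints, and equals one at the
  -- maximum points.
  let b : unitInterval → ℝ := fun t => max 0 (Φ (γ t) - m) / (M - m)
  have hb : Continuous b := by
    have := γ.continuous
    fun_prop
  have hb0 : ∀ t, 0 ≤ b t := fun t => div_nonneg (le_max_left _ _) (by linarith)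
  have hb1 : ∀ t, b t ≤ 1 := fun t => by
    rw [div_le_one (by linarith)]
    exact max_le (by linarith) (by linarith [hle t])
  -- The maximum with `ε` in the denominator keeps the field continuous where the gradient vanishes.
  -- At maximum points the gradient is longer than `ε` by assumption, so there the field is the unit
  -- steepest descent direction, with slope below `-ε`.
  let w : C(unitInterval, X) :=
    ⟨fun t => -(b t / max ‖g t‖ ε) • g t, by
      refine Continuous.smul (Continuous.neg (hb.div (by fun_prop) fun t => ?_)) hg
      have := le_max_right ‖g t‖ ε
      linarith⟩
  have hw : ∀ t, ‖w t‖ ≤ 1 := by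
    intro t
    have h2 : 0 < max ‖g t‖ ε := lt_of_lt_of_le hε (le_max_right _ _)
    have h3 : ‖w t‖ = b t / max ‖g t‖ ε * ‖g t‖ := by
      change ‖-(b t / max ‖g t‖ ε) • g t‖ = _
      rw [norm_smul, norm_neg, Real.norm_of_nonneg (div_nonneg (hb0 t) h2.le)]
    rw [h3, div_mul_eq_mul_div, div_le_one h2]
    calc b t * ‖g t‖ ≤ 1 * ‖g t‖ := by gcongr; exact hb1 t
      _ ≤ _ := by rw [one_mul]; exact le_max_left _ _
  have hw0 : ∀ t, Φ (γ t) ≤ m → w t = 0 := by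
    intro t ht
    have : b t = 0 := by simp [b, max_eq_left (sub_nonpos.2 ht)]
    change -(b t / max ‖g t‖ ε) • g t = 0
    simp [this]
  have hwM : ∀ t, Φ (γ t) = M → fderiv ℝ Φ (γ t) (w t) < -ε := by
    intro t ht
    have h2 : ε < ‖g t‖ := by rw [hgn]; exact hcon t ht
    have h3 : b t = 1 := by
      simp only [b, ht]
      rw [max_eq_right (by linarith), div_self (by linarith)]
    rw [hgi]
    change inner ℝ (g t) (-(b t / max ‖g t‖ ε) • g t) < -ε
    rw [inner_smul_right, real_inner_self_eq_norm_sq, h3, max_eq_left h2.le]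
    have : ‖g t‖ ≠ 0 := by linarith
    field_simp
    linarith
  let h : ℕ → ℝ := fun n => 1 / ((n : ℝ) + 1)
  have hh : ∀ n, 0 < h n := fun n => Nat.one_div_pos_of_nat
  have hh0 : Tendsto h atTop (𝓝 0) := tendsto_one_div_add_atTop_nhds_zero_nat
  have hkey : ∀ n, ∃ t, M ≤ Φ (γ t + h n • w t) + ε * h n := by
    intro n
    obtain ⟨t, ht⟩ := hmin (γ + h n • w)
      (by simp [hw0 0 (le_max_left _ _)]) (by simp [hw0 1 (le_max_right _ _)])
    refine ⟨t, ht.trans ?_⟩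
    have : ‖γ + h n • w - γ‖ ≤ h n := by
      rw [add_sub_cancel_left, ContinuousMap.norm_le _ (hh n).le]
      intro t
      rw [ContinuousMap.smul_apply, norm_smul, Real.norm_of_nonneg (hh n).le]
      exact mul_le_of_le_one_right (hh n).le (hw t)
    simp only [ContinuousMap.add_apply, ContinuousMap.smul_apply]
    gcongr
  choose t ht using hkey
  have hmv : ∀ n, ∃ s ∈ Set.Ioo (0 : ℝ) 1,
      -ε ≤ fderiv ℝ Φ (γ (t n) + (s * h n) • w (t n)) (w (t n)) := by
    intro n
    have hder : ∀ s : ℝ, HasDerivAt (fun s : ℝ => Φ (γ (t n) + (s * h n) • w (t n)))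
        (fderiv ℝ Φ (γ (t n) + (s * h n) • w (t n)) (h n • w (t n))) s := by
      intro s
      have h2 : HasDerivAt (fun s : ℝ => γ (t n) + (s * h n) • w (t n)) (h n • w (t n)) s := by
        simpa using (((hasDerivAt_id s).mul_const (h n)).smul_const (w (t n))).const_add (γ (t n))
      exact (hd _).hasFDerivAt.comp_hasDerivAt s h2
    obtain ⟨s, hs, hse⟩ := exists_hasDerivAt_eq_slope _ _ zero_lt_one
      (fun s _ => (hder s).continuousAt.continuousWithinAt) (fun s _ => hder s)
    refine ⟨s, hs, ?_⟩
    simp only [map_smul, smul_eq_mul, one_mul, zero_mul, zero_smul, add_zero, sub_zero,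
      div_one] at hse
    have h3 : -ε * h n ≤ h n * fderiv ℝ Φ (γ (t n) + (s * h n) • w (t n)) (w (t n)) := by
      rw [hse]
      linarith [ht n, hle (t n)]
    rw [mul_comm] at h3
    exact le_of_mul_le_mul_left h3 (hh n)
  choose s hs hsd using hmv
  -- Points that defeat the deformation of size `h n` accumulate, as `h n → 0`, at a maximum point
  -- where the slope along `w` is at least `-ε`, against `hwM`.
  obtain ⟨τ, -, φ, hφ, hτ⟩ := isCompact_univ.tendsto_subseq (x := t) (fun _ => Set.mem_univ _)
  have hhφ : Tendsto (fun n => h (φ n)) atTop (𝓝 0) := hh0.comp hφ.tendsto_atTop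
  have hγτ : Tendsto (fun n => γ (t (φ n))) atTop (𝓝 (γ τ)) := (γ.continuous.tendsto τ).comp hτ
  have hwτ : Tendsto (fun n => w (t (φ n))) atTop (𝓝 (w τ)) := (w.continuous.tendsto τ).comp hτ
  have hshφ : Tendsto (fun n => s (φ n) * h (φ n)) atTop (𝓝 0) := by
    refine squeeze_zero (fun n => mul_nonneg (hs _).1.le (hh _).le) (fun n => ?_) hhφ
    exact mul_le_of_le_one_left (hh _).le (hs _).2.le
  have hΦτ : Φ (γ τ) = M := by
    refine le_antisymm (hle τ) ?_
    have h2 : Tendsto (fun n => Φ (γ (t (φ n)) + h (φ n) • w (t (φ n))) + ε * h (φ n)) atTop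
        (𝓝 (Φ (γ τ + (0 : ℝ) • w τ) + ε * 0)) :=
      ((hΦc.tendsto _).comp (hγτ.add (hhφ.smul hwτ))).add (hhφ.const_mul ε)
    simp only [zero_smul, add_zero, mul_zero] at h2
    exact ge_of_tendsto' h2 fun n => ht (φ n)
  have h3 : Tendsto (fun n => fderiv ℝ Φ (γ (t (φ n)) + (s (φ n) * h (φ n)) • w (t (φ n)))
      (w (t (φ n)))) atTop (𝓝 (fderiv ℝ Φ (γ τ + (0 : ℝ) • w τ) (w τ))) :=
    (isBoundedBilinearMap_apply.continuous.tendsto (fderiv ℝ Φ (γ τ + (0 : ℝ) • w τ), w τ)).comp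
      (((hDc.tendsto _).comp (hγτ.add (hshφ.smul hwτ))).prodMk_nhds hwτ)
  simp only [zero_smul, add_zero] at h3
  exact absurd (ge_of_tendsto' h3 fun n => hsd (φ n)) (not_le.2 (hwM τ hΦτ))

/-- A localized mountain pass theorem: if every path with the endpoints of `γ₀` meets `{m ≤ Φ}`
and `Φ ≤ m + ε²` along `γ₀`, then there is an almost critical point at distance at most `ε`
from `γ₀`. -/
theorem exists_almost_critical_near_path {Φ : X → ℝ} (hΦ : ContDiff ℝ 1 Φ) {ε m : ℝ} (hε : 0 < ε)
    (γ₀ : C(unitInterval, X)) (h0 : Φ (γ₀ 0) < m) (h1 : Φ (γ₀ 1) < m)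
    (hm : ∀ γ : C(unitInterval, X), γ 0 = γ₀ 0 → γ 1 = γ₀ 1 → ∃ t, m ≤ Φ (γ t))
    (hγ₀ : ∀ t, Φ (γ₀ t) ≤ m + ε ^ 2) :
    ∃ x t, ‖x - γ₀ t‖ ≤ ε ∧ m ≤ Φ x ∧ Φ x ≤ m + ε ^ 2 ∧ ‖fderiv ℝ Φ x‖ ≤ ε := by
  have hΦc : Continuous Φ := hΦ.continuous
  let P : Set C(unitInterval, X) := {γ | γ 0 = γ₀ 0 ∧ γ 1 = γ₀ 1}
  have hP : IsClosed P := by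
    refine IsClosed.inter (isClosed_eq ?_ continuous_const) (isClosed_eq ?_ continuous_const) <;>
    fun_prop
  have : CompleteSpace P := hP.completeSpace_coe
  have hmax : ∀ γ : C(unitInterval, X), ∃ t, ∀ s, Φ (γ s) ≤ Φ (γ t) := by
    intro γ
    obtain ⟨t, -, ht⟩ := isCompact_univ.exists_isMaxOn Set.univ_nonempty
      (hΦc.comp γ.continuous).continuousOn
    exact ⟨t, fun s => ht (Set.mem_univ s)⟩
  choose τ hτ using hmax
  let ψ : P → ℝ := fun γ => Φ (γ.1 (τ γ.1))
  -- Freezing the maximizing time of `γ` bounds `ψ` below near `γ` by a continuous evaluation, so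
  -- the discontinuous choice `τ` does no harm.
  have hψ : LowerSemicontinuous ψ := by
    intro γ y hy
    have hc : Continuous fun η : P => Φ (η.1 (τ γ.1)) := by
      refine hΦc.comp ?_
      exact (continuous_eval_const (τ γ.1)).comp continuous_subtype_val
    filter_upwards [hc.tendsto γ (lt_mem_nhds hy)] with η hη
    exact lt_of_lt_of_le hη (hτ η.1 _)
  have hψm : ∀ γ, m ≤ ψ γ := by
    intro γ
    obtain ⟨t, ht⟩ := hm γ.1 γ.2.1 γ.2.2
    exact ht.trans (hτ _ _)
  obtain ⟨γ, hγ1, hγ2⟩ := ekeland hψ hψm hε ⟨γ₀, rfl, rfl⟩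
  have hdist : ‖γ.1 - γ₀‖ ≤ ε := by
    have h2 : dist (⟨γ₀, rfl, rfl⟩ : P) γ = ‖γ.1 - γ₀‖ := by
      rw [Subtype.dist_eq, dist_comm, dist_eq_norm]
    rw [h2] at hγ1
    have h3 : ψ ⟨γ₀, rfl, rfl⟩ ≤ m + ε ^ 2 := hγ₀ _
    have h4 := hψm γ
    -- The margin `ε²` above the level is what turns the Ekeland penalty into the distance bound
    -- `ε`.
    have h5 : ε * ‖γ.1 - γ₀‖ ≤ ε * ε := by nlinarith
    exact le_of_mul_le_mul_left h5 hε
  have hup : ψ γ ≤ m + ε ^ 2 := by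
    have h3 : ψ ⟨γ₀, rfl, rfl⟩ ≤ m + ε ^ 2 := hγ₀ _
    have : 0 ≤ ε * dist (⟨γ₀, rfl, rfl⟩ : P) γ := by positivity
    linarith
  obtain ⟨t, ht1, ht2⟩ := exists_fderiv_le_of_path_almost_minimal hΦ hε γ.1 (M := ψ γ)
    ⟨⟨_, rfl⟩, by rintro _ ⟨s, rfl⟩; exact hτ _ s⟩
    (by rw [γ.2.1]; exact h0.trans_le (hψm γ)) (by rw [γ.2.2]; exact h1.trans_le (hψm γ))
    (fun η e0 e1 => by
      refine ⟨τ η, ?_⟩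
      have := hγ2 ⟨η, e0.trans γ.2.1, e1.trans γ.2.2⟩
      rwa [Subtype.dist_eq, dist_comm, dist_eq_norm] at this)
  refine ⟨γ.1 t, t, ?_, ?_, ?_, ht2⟩
  · exact (ContinuousMap.norm_coe_le_norm (γ.1 - γ₀) t).trans hdist
  · rw [ht1]; exact hψm γ
  · rw [ht1]; exact hup

end Minimax

/-! ### The Sobolev embedding into `L⁶`. -/

/-- Young's inequality in `L²` for the convolution with a kernel of mass at most one. -/
theorem eLpNorm_two_le_of_enorm_le_convolution {F₁ F₂ : Type*} [NormedAddCommGroup F₁]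
    [NormedAddCommGroup F₂] {k : R3 → ℝ≥0∞} (hk : Measurable k) (hk1 : ∫⁻ x, k x ≤ 1)
    {f : R3 → F₁} {h : R3 → F₂} (hh : StronglyMeasurable h)
    (hf : ∀ x, ‖f x‖ₑ ≤ ∫⁻ y, k (x - y) * ‖h y‖ₑ) :
    eLpNorm f 2 volume ≤ eLpNorm h 2 volume := by
  rw [eLpNorm_eq_lintegral_rpow_enorm_toReal (by simp) (by simp),
    eLpNorm_eq_lintegral_rpow_enorm_toReal (by simp) (by simp)]
  gcongr ?_ ^ _
  simp only [ENNReal.toReal_ofNat]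
  have hhm : Measurable fun y => ‖h y‖ₑ := hh.enorm
  have hkx : ∀ y, ∫⁻ x, k (x - y) ≤ 1 := fun y => by
    rw [lintegral_sub_right_eq_self k y]; exact hk1
  have hky : ∀ x, ∫⁻ y, k (x - y) ≤ 1 := fun x => by
    rw [lintegral_sub_left_eq_self k x]; exact hk1
  have hpt : ∀ x, ‖f x‖ₑ ^ (2 : ℝ) ≤ ∫⁻ y, k (x - y) * ‖h y‖ₑ ^ (2 : ℝ) := by
    intro x
    have hkm : Measurable fun y => k (x - y) := hk.comp (measurable_const.sub measurable_id)
    -- Cauchy–Schwarz after writing `k = k^{1/2} k^{1/2}`; the factor without `h` has mass at most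
    -- one.
    have h1 : ‖f x‖ₑ ≤ (∫⁻ y, k (x - y) * ‖h y‖ₑ ^ (2 : ℝ)) ^ (1 / 2 : ℝ) := by
      calc ‖f x‖ₑ ≤ ∫⁻ y, k (x - y) * ‖h y‖ₑ := hf x
        _ = ∫⁻ y, k (x - y) ^ (1 / 2 : ℝ) * (k (x - y) * ‖h y‖ₑ ^ (2 : ℝ)) ^ (1 / 2 : ℝ) := by
            congr 1 with y
            rw [ENNReal.mul_rpow_of_nonneg _ _ (by norm_num), ← mul_assoc,
              ← ENNReal.rpow_add_of_nonneg _ _ (by norm_num) (by norm_num), ← ENNReal.rpow_mul]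
            norm_num
        _ ≤ (∫⁻ y, k (x - y)) ^ (1 / 2 : ℝ) *
              (∫⁻ y, k (x - y) * ‖h y‖ₑ ^ (2 : ℝ)) ^ (1 / 2 : ℝ) :=
            ENNReal.lintegral_mul_norm_pow_le hkm.aemeasurable
              (hkm.mul (hhm.pow_const _)).aemeasurable (by norm_num) (by norm_num) (by norm_num)
        _ ≤ 1 ^ (1 / 2 : ℝ) * _ := by
            gcongr
            exact hky x
        _ = _ := by simp
    calc ‖f x‖ₑ ^ (2 : ℝ) ≤ ((∫⁻ y, k (x - y) * ‖h y‖ₑ ^ (2 : ℝ)) ^ (1 / 2 : ℝ)) ^ (2 : ℝ) := by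
          gcongr
      _ = _ := by rw [← ENNReal.rpow_mul]; norm_num
  calc ∫⁻ x, ‖f x‖ₑ ^ (2 : ℝ) ≤ ∫⁻ x, ∫⁻ y, k (x - y) * ‖h y‖ₑ ^ (2 : ℝ) := lintegral_mono hpt
    _ = ∫⁻ y, ∫⁻ x, k (x - y) * ‖h y‖ₑ ^ (2 : ℝ) := by
        apply lintegral_lintegral_swap
        apply Measurable.aemeasurable
        exact (hk.comp (measurable_fst.sub measurable_snd)).mul
          ((hhm.comp measurable_snd).pow_const _)
    _ ≤ ∫⁻ y, ‖h y‖ₑ ^ (2 : ℝ) := by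
        refine lintegral_mono fun y => ?_
        have hkm : Measurable fun x => k (x - y) := hk.comp (measurable_id.sub measurable_const)
        rw [lintegral_mul_const _ hkm]
        exact mul_le_of_le_one_left' (hkx y)

namespace SchrodingerPoisson

open ContinuousLinearMap in
/-- Derivative of a mollification in terms of the weak gradient. -/
theorem IsWeakGradient.fderiv_convolution_apply {u : R3 → ℝ} {g : R3 → R3}
    (hug : IsWeakGradient u g) (hu : LocallyIntegrable u volume) {ρ : R3 → ℝ}
    (hρ : ContDiff ℝ ∞ ρ) (hρc : HasCompactSupport ρ) (x v : R3) :
    fderiv ℝ (convolution ρ u (lsmul ℝ ℝ) volume) x v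
      = ∫ y, ρ (x - y) * inner ℝ (g y) v := by
  have hρ1 : ContDiff ℝ 1 ρ := hρ.of_le (by simp)
  rw [(hρc.hasFDerivAt_convolution_left (lsmul ℝ ℝ) hρ1 hu x).fderiv, convolution_eq_swap,
    ContinuousLinearMap.integral_apply]
  · have hφ : ContDiff ℝ ∞ fun y => ρ (x - y) := hρ.comp (contDiff_const.sub contDiff_id)
    have hφc : HasCompactSupport fun y => ρ (x - y) :=
      hρc.comp_homeomorph (Homeomorph.subLeft x)
    have hd : ∀ y, fderiv ℝ (fun y => ρ (x - y)) y v = - fderiv ℝ ρ (x - y) v := by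
      intro y
      have h1 : HasFDerivAt (fun y => ρ (x - y))
          ((fderiv ℝ ρ (x - y)).comp (-ContinuousLinearMap.id ℝ R3)) y :=
        ((hρ1.differentiable one_ne_zero) (x - y)).hasFDerivAt.comp y
          ((hasFDerivAt_id y).const_sub x)
      rw [h1.fderiv]
      simp
    have := hug _ hφ hφc v
    simp only [hd, mul_neg, integral_neg, neg_inj] at this
    simp only [precompL_apply, lsmul_apply, smul_eq_mul]
    simp only [mul_comm] at this ⊢
    exact this
  · have := ((hρc.fderiv ℝ).convolutionExists_left ((lsmul ℝ ℝ : ℝ →L[ℝ] ℝ →L[ℝ] ℝ).precompL R3)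
      (hρ1.continuous_fderiv one_ne_zero) hu x).integrable_swap
    exact this

/-- The derivative of a mollification is the mollification of the weak gradient. This form lets
Young's inequality bound it in `L²`. -/
theorem IsWeakGradient.norm_fderiv_convolution_le {u : R3 → ℝ} {g : R3 → R3}
    (hug : IsWeakGradient u g) (hu : LocallyIntegrable u volume)
    (hg : LocallyIntegrable g volume) {ρ : R3 → ℝ}
    (hρ : ContDiff ℝ ∞ ρ) (hρc : HasCompactSupport ρ) (x : R3) :
    ‖fderiv ℝ (convolution ρ u (ContinuousLinearMap.lsmul ℝ ℝ) volume) x‖ₑ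
      ≤ ∫⁻ y, ‖ρ (x - y)‖ₑ * ‖g y‖ₑ := by
  have hint : Integrable (fun y => ρ (x - y) • g y) := by
    have := (hρc.convolutionExists_left (ContinuousLinearMap.lsmul ℝ ℝ : ℝ →L[ℝ] R3 →L[ℝ] R3)
      hρ.continuous hg x).integrable_swap
    simpa using this
  have h1 : ‖fderiv ℝ (convolution ρ u (ContinuousLinearMap.lsmul ℝ ℝ) volume) x‖
      ≤ ∫ y, ‖ρ (x - y) • g y‖ := by
    refine ContinuousLinearMap.opNorm_le_bound _ (integral_nonneg fun _ => norm_nonneg _) ?_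
    intro v
    rw [hug.fderiv_convolution_apply hu hρ hρc, ← integral_mul_const]
    refine norm_integral_le_of_norm_le (hint.norm.mul_const _) (ae_of_all _ fun y => ?_)
    rw [norm_mul, norm_smul, mul_assoc]
    gcongr
    exact norm_inner_le_norm _ _
  rw [← ofReal_norm]
  refine (ENNReal.ofReal_le_ofReal h1).trans ?_
  rw [ofReal_integral_norm_eq_lintegral_enorm hint]
  simp only [enorm_smul, le_refl]

/-- The Sobolev embedding `H¹(ℝ³) → L⁶(ℝ³)`, at the level of functions. -/
theorem exists_eLpNorm_six_le : ∃ C : NNReal, ∀ (u : R3 → ℝ) (g : R3 → R3),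
    StronglyMeasurable u → StronglyMeasurable g → MemLp u 2 volume → MemLp g 2 volume →
    IsWeakGradient u g →
    eLpNorm u 6 volume ≤ C * (eLpNorm g 2 volume + eLpNorm u 2 volume) := by
  let η : ContDiffBump (0 : R3) := ⟨1, 2, by norm_num, by norm_num⟩
  have hη1 : ContDiff ℝ 1 η := η.contDiff
  obtain ⟨B, hB⟩ := (hη1.continuous_fderiv one_ne_zero).bounded_above_of_compact_support
    (η.hasCompactSupport.fderiv ℝ)
  have hB0 : 0 ≤ B := (norm_nonneg _).trans (hB 0)
  let S : NNReal := SNormLESNormFDerivOfEqConst ℝ (volume : Measure R3) 2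
  refine ⟨S * (1 + B.toNNReal), fun u g hum hgm hu hg hug => ?_⟩
  have hul : LocallyIntegrable u volume := hu.locallyIntegrable (by norm_num)
  have hgl : LocallyIntegrable g volume := hg.locallyIntegrable (by norm_num)
  let r : ℕ → ℝ := fun n => 1 / ((n : ℝ) + 1)
  have hr : ∀ n, 0 < r n := fun n => Nat.one_div_pos_of_nat
  have hr1 : ∀ n, r n ≤ 1 := fun n => by
    rw [div_le_one (by positivity)]; linarith [n.cast_nonneg (α := ℝ)]
  have hr0 : Tendsto r atTop (𝓝 0) := tendsto_one_div_add_atTop_nhds_zero_nat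
  let ρ : ℕ → ContDiffBump (0 : R3) := fun n =>
    ⟨r n / 2, r n, half_pos (hr n), half_lt_self (hr n)⟩
  let c : ℕ → R3 → ℝ := fun n => convolution ((ρ n).normed volume) u
    (ContinuousLinearMap.lsmul ℝ ℝ) volume
  have hconv : ∀ᵐ x, Tendsto (fun n => c n x) atTop (𝓝 (u x)) :=
    ContDiffBump.ae_convolution_tendsto_right_of_locallyIntegrable (K := 2) hr0
      (Eventually.of_forall fun n => le_of_eq (by simp [ρ]; ring)) hul
  -- Mollification gives smoothness and the cutoff at radius of order `1 / r n` gives compact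
  -- support, as the Gagliardo–Nirenberg–Sobolev inequality requires. Since `r n ≤ 1`, the
  -- derivative of the cutoff stays below `B` for all `n`.
  let w : ℕ → R3 → ℝ := fun n x => η (r n • x) * c n x
  have hwlim : ∀ᵐ x, Tendsto (fun n => w n x) atTop (𝓝 (u x)) := by
    filter_upwards [hconv] with x hx
    have h1 : Tendsto (fun n => η (r n • x)) atTop (𝓝 (η ((0 : ℝ) • x))) :=
      (η.continuous.tendsto _).comp (hr0.smul_const x)
    have h2 : η ((0 : ℝ) • x) = 1 := η.one_of_mem_closedBall (by simp [η])
    rw [h2] at h1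
    simpa using h1.mul hx
  have hcd : ∀ n, ContDiff ℝ 1 (c n) := fun n =>
    (ρ n).hasCompactSupport_normed.contDiff_convolution_left _ (n := 1)
      ((ρ n).contDiff_normed) hul
  have hηn : ∀ n, ContDiff ℝ 1 fun x : R3 => η (r n • x) := fun n =>
    hη1.comp (contDiff_const_smul _)
  have hwd : ∀ n, ContDiff ℝ 1 (w n) := fun n => (hηn n).mul (hcd n)
  have hwc : ∀ n, HasCompactSupport (w n) := fun n =>
    (η.hasCompactSupport.comp_smul (hr n).ne').mul_right
  have hkm : ∀ n, Measurable fun x => ‖(ρ n).normed volume x‖ₑ := fun n =>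
    (ρ n).continuous_normed.measurable.enorm
  have hk1 : ∀ n, ∫⁻ x, ‖(ρ n).normed volume x‖ₑ ≤ 1 := fun n => by
    rw [← ofReal_integral_norm_eq_lintegral_enorm (ρ n).integrable_normed]
    simp only [Real.norm_of_nonneg ((ρ n).nonneg_normed _), (ρ n).integral_normed]
    simp
  have hdc : ∀ n, eLpNorm (fderiv ℝ (c n)) 2 volume ≤ eLpNorm g 2 volume := fun n =>
    eLpNorm_two_le_of_enorm_le_convolution (hkm n) (hk1 n) hgm fun x =>
      hug.norm_fderiv_convolution_le hul hgl (ρ n).contDiff_normed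
        (ρ n).hasCompactSupport_normed x
  have hcu : ∀ n, eLpNorm (c n) 2 volume ≤ eLpNorm u 2 volume := fun n =>
    eLpNorm_two_le_of_enorm_le_convolution (hkm n) (hk1 n) hum fun x => by
      simp only [c]
      rw [convolution_eq_swap]
      refine (enorm_integral_le_lintegral_enorm _).trans (le_of_eq ?_)
      simp only [ContinuousLinearMap.lsmul_apply, enorm_smul]
  have hdw : ∀ n, eLpNorm (fderiv ℝ (w n)) 2 volume
      ≤ eLpNorm g 2 volume + ENNReal.ofReal B * eLpNorm u 2 volume := by
    intro n
    have hpt : ∀ x, ‖fderiv ℝ (w n) x‖ ≤ ‖‖fderiv ℝ (c n) x‖ + B * ‖c n x‖‖ := by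
      intro x
      have hd1 : DifferentiableAt ℝ (fun x : R3 => η (r n • x)) x :=
        (hηn n).differentiable one_ne_zero x
      have hd2 : DifferentiableAt ℝ (c n) x := (hcd n).differentiable one_ne_zero x
      have h1 : fderiv ℝ (fun x : R3 => η (r n • x)) x = r n • fderiv ℝ η (r n • x) := by
        rw [fderiv_comp_smul]
      have h2 : fderiv ℝ (w n) x = η (r n • x) • fderiv ℝ (c n) x
          + c n x • fderiv ℝ (fun x : R3 => η (r n • x)) x := fderiv_mul hd1 hd2
      rw [h2, h1, Real.norm_of_nonneg (by positivity)]
      refine (norm_add_le _ _).trans ?_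
      rw [norm_smul, norm_smul, norm_smul, Real.norm_of_nonneg η.nonneg,
        Real.norm_of_nonneg (hr n).le, mul_comm B]
      gcongr
      · exact mul_le_of_le_one_left (norm_nonneg _) η.le_one
      · calc r n * ‖fderiv ℝ η (r n • x)‖ ≤ 1 * B := by
              gcongr
              · exact hr1 n
              · exact hB _
          _ = B := one_mul B
    refine (eLpNorm_mono hpt).trans ?_
    refine (eLpNorm_add_le ?_ ?_ (by norm_num)).trans ?_
    · exact (((hcd n).continuous_fderiv one_ne_zero).norm).aestronglyMeasurable
    · exact (((hcd n).continuous.norm).const_smul B).aestronglyMeasurable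
    · have h3 : eLpNorm (fun x => B * ‖c n x‖) 2 volume
          = ENNReal.ofReal B * eLpNorm (c n) 2 volume := by
        rw [← eLpNorm_norm (c n)]
        have := eLpNorm_const_smul B (fun x => ‖c n x‖) 2 (volume : Measure R3)
        rw [← ofReal_norm, Real.norm_of_nonneg hB0] at this
        exact this
      rw [h3, eLpNorm_norm]
      gcongr
      · exact hdc n
      · exact hcu n
  have hwb : ∀ n, eLpNorm (w n) 6 volume
      ≤ (S * (1 + B.toNNReal) : NNReal) * (eLpNorm g 2 volume + eLpNorm u 2 volume) := by
    intro n
    have hs : eLpNorm (w n) ((6 : NNReal) : ℝ≥0∞) volume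
        ≤ S * eLpNorm (fderiv ℝ (w n)) ((2 : NNReal) : ℝ≥0∞) volume :=
      eLpNorm_le_eLpNorm_fderiv_of_eq volume (p := 2) (p' := 6) (hwd n) (hwc n) (by norm_num)
        (by simp) (by simp; norm_num)
    have hs' : eLpNorm (w n) 6 volume ≤ S * eLpNorm (fderiv ℝ (w n)) 2 volume := by
      exact_mod_cast hs
    refine hs'.trans ?_
    push_cast
    rw [mul_assoc]
    gcongr
    refine (hdw n).trans ?_
    rw [mul_add]
    gcongr
    · exact le_mul_of_one_le_left' le_self_add
    · exact le_add_self
  -- Fatou's lemma carries the uniform `L⁶` bound to the almost everywhere limit.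
  refine (Lp.eLpNorm_lim_le_liminf_eLpNorm (fun n => (hwd n).continuous.aestronglyMeasurable)
    u hwlim).trans ?_
  refine liminf_le_of_le (by isBoundedDefault) fun b hb => ?_
  obtain ⟨n, hn⟩ := hb.exists
  exact hn.trans (hwb n)

/-! ### `H¹` as a Hilbert space. -/

theorem continuous_integral_mul_left {ψ : R3 → ℝ} (hψ : MemLp ψ 2 volume) :
    Continuous fun u : Lp ℝ 2 (volume : Measure R3) => ∫ x, u x * ψ x := by
  have h : (fun u : Lp ℝ 2 (volume : Measure R3) => ∫ x, u x * ψ x)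
      = fun u => inner ℝ (hψ.toLp ψ) u := by
    ext u
    rw [L2.inner_def]
    refine integral_congr_ae ?_
    filter_upwards [hψ.coeFn_toLp] with x hx
    simp [hx]
  rw [h]
  fun_prop

theorem continuous_integral_inner_mul {ψ : R3 → ℝ} (hψ : MemLp ψ 2 volume) (v : R3) :
    Continuous fun g : Lp R3 2 (volume : Measure R3) => ∫ x, inner ℝ (g x) v * ψ x := by
  have hψv : MemLp (fun x => ψ x • v) 2 volume :=
    ((ContinuousLinearMap.toSpanSingleton ℝ v).comp_memLp' hψ)
  have h : (fun g : Lp R3 2 (volume : Measure R3) => ∫ x, inner ℝ (g x) v * ψ x)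
      = fun g => inner ℝ (hψv.toLp _) g := by
    ext g
    rw [L2.inner_def]
    refine integral_congr_ae ?_
    filter_upwards [hψv.coeFn_toLp] with x hx
    rw [hx, real_inner_smul_left, real_inner_comm, mul_comm]
  rw [h]
  fun_prop

/-- Each test function gives a linear condition whose two sides are `L²` pairings, hence continuous
in the pair. The resulting completeness is needed both for Ekeland's principle and for Riesz
representatives. -/
theorem isClosed_sobolevH1 : IsClosed (sobolevH1 : Set L2Pair) := by
  have h : (sobolevH1 : Set L2Pair) = ⋂ (φ : R3 → ℝ) (_ : ContDiff ℝ ∞ φ)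
      (_ : HasCompactSupport φ) (v : R3),
      {w : L2Pair | ∫ x, w.fst x * fderiv ℝ φ x v = - ∫ x, inner ℝ (w.snd x) v * φ x} := by
    ext w
    simp only [Set.mem_iInter, Set.mem_ofPred_eq]
    rfl
  rw [h]
  refine isClosed_iInter fun φ => isClosed_iInter fun hφ => isClosed_iInter fun hc =>
    isClosed_iInter fun v => isClosed_eq ?_ (Continuous.neg ?_)
  · exact (continuous_integral_mul_left (memLp_fderiv_apply hφ hc v)).comp
      (WithLp.prod_continuous_ofLp 2 _ _).fst
  · exact (continuous_integral_inner_mul (hφ.continuous.memLp_of_hasCompactSupport hc) v).comp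
      (WithLp.prod_continuous_ofLp 2 _ _).snd

instance instCompleteSpaceH1 : CompleteSpace H1 := isClosed_sobolevH1.completeSpace_coe

/-- `u ↦ u` from `H¹` to `L²`. -/
noncomputable def H1.toL2 : H1 →L[ℝ] Lp ℝ 2 (volume : Measure R3) :=
  (WithLp.fstL 2 ℝ _ _).comp sobolevH1.subtypeL

/-- `u ↦ ∇u` from `H¹` to `L²`. -/
noncomputable def H1.gradL2 : H1 →L[ℝ] Lp R3 2 (volume : Measure R3) :=
  (WithLp.sndL 2 ℝ _ _).comp sobolevH1.subtypeL

theorem H1.norm_sq (u : H1) : ‖u‖ ^ 2 = ‖H1.toL2 u‖ ^ 2 + ‖H1.gradL2 u‖ ^ 2 :=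
  WithLp.prod_norm_sq_eq_of_L2 u.1

theorem integral_norm_sq_Lp {E : Type*} [NormedAddCommGroup E] [InnerProductSpace ℝ E]
    (f : Lp E 2 (volume : Measure R3)) : ∫ x, ‖f x‖ ^ 2 = ‖f‖ ^ 2 := by
  rw [← real_inner_self_eq_norm_sq, L2.inner_def]
  simp only [real_inner_self_eq_norm_sq]

theorem gradTerm_eq (u : H1) : gradTerm u = ‖H1.gradL2 u‖ ^ 2 := integral_norm_sq_Lp _

theorem massTerm_eq (u : H1) : massTerm u = ‖H1.toL2 u‖ ^ 2 := by
  rw [← integral_norm_sq_Lp]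
  simp only [Real.norm_eq_abs, sq_abs]
  rfl

theorem norm_sq_eq_gradTerm_add_massTerm (u : H1) : ‖u‖ ^ 2 = gradTerm u + massTerm u := by
  rw [u.norm_sq, gradTerm_eq, massTerm_eq, add_comm]

theorem contDiff_gradTerm : ContDiff ℝ 1 gradTerm := by
  rw [funext gradTerm_eq]
  exact H1.gradL2.contDiff.norm_sq ℝ

theorem contDiff_massTerm : ContDiff ℝ 1 massTerm := by
  rw [funext massTerm_eq]
  exact H1.toL2.contDiff.norm_sq ℝ

theorem H1.stronglyMeasurable_val (u : H1) : StronglyMeasurable u.val := Lp.stronglyMeasurable _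

theorem H1.val_add (u v : H1) : (u + v).val =ᵐ[volume] fun x => u.val x + v.val x :=
  Lp.coeFn_add _ _

theorem H1.val_smul (c : ℝ) (u : H1) : (c • u).val =ᵐ[volume] fun x => c * u.val x :=
  Lp.coeFn_smul _ _

theorem H1.memLp_two (u : H1) : MemLp u.val 2 volume := Lp.memLp _

/-! ### Hölder estimates on `H¹`. -/

theorem H1.exists_eLpNorm_six_le : ∃ C : NNReal, ∀ u : H1, eLpNorm u.val 6 volume ≤ C * ‖u‖ₑ := by
  obtain ⟨C, hC⟩ := SchrodingerPoisson.exists_eLpNorm_six_le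
  refine ⟨C * 2, fun u => ?_⟩
  refine (hC u.val u.grad u.stronglyMeasurable_val (Lp.stronglyMeasurable _) (Lp.memLp _)
    (Lp.memLp _) u.2).trans ?_
  have h1 : eLpNorm u.val 2 volume ≤ ‖u‖ₑ := by
    have : ‖H1.toL2 u‖ ≤ ‖u‖ := abs_le_of_sq_le_sq' (by nlinarith [u.norm_sq]) (norm_nonneg _) |>.2
    rw [show eLpNorm u.val 2 volume = ‖H1.toL2 u‖ₑ from (Lp.enorm_def _).symm, ← ofReal_norm,
      ← ofReal_norm]
    exact ENNReal.ofReal_le_ofReal this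
  have h2 : eLpNorm u.grad 2 volume ≤ ‖u‖ₑ := by
    have : ‖H1.gradL2 u‖ ≤ ‖u‖ :=
      abs_le_of_sq_le_sq' (by nlinarith [u.norm_sq]) (norm_nonneg _) |>.2
    rw [show eLpNorm u.grad 2 volume = ‖H1.gradL2 u‖ₑ from (Lp.enorm_def _).symm, ← ofReal_norm,
      ← ofReal_norm]
    exact ENNReal.ofReal_le_ofReal this
  push_cast
  rw [mul_assoc, two_mul]
  gcongr

theorem H1.integrable_mul (u v : H1) : Integrable (fun x => u.val x * v.val x) volume :=
  MemLp.integrable_mul (p := 2) (q := 2) u.memLp_two v.memLp_two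

theorem H1.integral_abs_mul_le (u v : H1) : ∫ x, |u.val x| * |v.val x| ≤ ‖u‖ * ‖v‖ := by
  have hle : ∀ w : H1, ‖H1.toL2 w‖ ≤ ‖w‖ := fun w =>
    (abs_le_of_sq_le_sq' (by nlinarith [w.norm_sq]) (norm_nonneg _)).2
  have h := integral_mul_norm_le_Lp_mul_Lq (μ := (volume : Measure R3)) (p := 2) (q := 2)
    Real.HolderConjugate.two_two (f := u.val) (g := v.val) (by simpa using u.memLp_two)
    (by simpa using v.memLp_two)
  have h2 : ∀ w : H1, (∫ x, ‖w.val x‖ ^ (2 : ℝ)) ^ (1 / 2 : ℝ) = ‖H1.toL2 w‖ := by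
    intro w
    have h3 : ∫ x, ‖w.val x‖ ^ (2 : ℝ) = ‖H1.toL2 w‖ ^ 2 := by
      simp only [Real.rpow_two]
      exact integral_norm_sq_Lp (H1.toL2 w)
    rw [h3, ← Real.sqrt_eq_rpow, Real.sqrt_sq (norm_nonneg _)]
  rw [h2, h2] at h
  simp only [Real.norm_eq_abs] at h
  exact h.trans (mul_le_mul (hle u) (hle v) (norm_nonneg _) (norm_nonneg _))

theorem H1.lintegral_enorm_mul_le (u v : H1) :
    ∫⁻ x, ‖u.val x‖ₑ * ‖v.val x‖ₑ ≤ ‖u‖ₑ * ‖v‖ₑ := by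
  have h := H1.integral_abs_mul_le u v
  have h2 := ofReal_integral_norm_eq_lintegral_enorm (u.integrable_mul v)
  simp only [enorm_mul] at h2
  rw [← h2, ← ofReal_norm, ← ofReal_norm, ← ENNReal.ofReal_mul (norm_nonneg _)]
  refine ENNReal.ofReal_le_ofReal (le_trans (le_of_eq ?_) h)
  simp only [norm_mul, Real.norm_eq_abs]

theorem lintegral_rpow_enorm_six (f : R3 → ℝ) :
    (∫⁻ x, ‖f x‖ₑ ^ (6 : ℝ)) ^ (1 / 6 : ℝ) = eLpNorm f 6 volume := by
  rw [eLpNorm_eq_lintegral_rpow_enorm_toReal (by simp) (by simp)]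
  simp

/-- Hölder's inequality with exponents `3/2, 6, 6`, combined with the Sobolev embedding. -/
theorem H1.exists_lintegral_mul_le : ∃ C : NNReal, ∀ (g : R3 → ℝ≥0∞) (v w : H1),
    AEMeasurable g volume →
    ∫⁻ x, g x ^ (2 / 3 : ℝ) * (‖v.val x‖ₑ * ‖w.val x‖ₑ)
      ≤ C * (∫⁻ x, g x) ^ (2 / 3 : ℝ) * (‖v‖ₑ * ‖w‖ₑ) := by
  obtain ⟨C, hC⟩ := H1.exists_eLpNorm_six_le
  refine ⟨C * C, fun g v w hg => ?_⟩
  have hv : AEMeasurable (fun x => ‖v.val x‖ₑ ^ (6 : ℝ)) volume :=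
    (v.stronglyMeasurable_val.enorm.pow_const _).aemeasurable
  have hw : AEMeasurable (fun x => ‖w.val x‖ₑ ^ (6 : ℝ)) volume :=
    (w.stronglyMeasurable_val.enorm.pow_const _).aemeasurable
  have h := ENNReal.lintegral_prod_norm_pow_le (μ := (volume : Measure R3))
    (Finset.univ : Finset (Fin 3))
    (f := ![g, fun x => ‖v.val x‖ₑ ^ (6 : ℝ), fun x => ‖w.val x‖ₑ ^ (6 : ℝ)])
    (p := ![2 / 3, 1 / 6, 1 / 6])
    (by intro i _; fin_cases i; exacts [hg, hv, hw])
    (by simp [Fin.sum_univ_three]; norm_num) (by simp [Fin.forall_fin_succ]; norm_num)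
  have hcancel : ∀ (f : R3 → ℝ) x, (‖f x‖ₑ ^ (6 : ℝ)) ^ (1 / 6 : ℝ) = ‖f x‖ₑ := fun f x => by
    rw [← ENNReal.rpow_mul]; norm_num
  simp only [Fin.prod_univ_three, Matrix.cons_val_zero, Matrix.cons_val_one, Matrix.cons_val,
    hcancel, lintegral_rpow_enorm_six] at h
  simp only [mul_assoc] at h
  refine h.trans ?_
  push_cast
  calc (∫⁻ x, g x) ^ (2 / 3 : ℝ) * (eLpNorm v.val 6 volume * eLpNorm w.val 6 volume)
      ≤ (∫⁻ x, g x) ^ (2 / 3 : ℝ) * ((C * ‖v‖ₑ) * (C * ‖w‖ₑ)) := by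
        gcongr
        · exact hC v
        · exact hC w
    _ = _ := by ring

/-- The case `g = |u|⁶` of `H1.exists_lintegral_mul_le`, with the Sobolev embedding applied to `u`.
-/
theorem H1.exists_lintegral_quartic_mul_le : ∃ C : NNReal, ∀ u v w : H1,
    ∫⁻ x, ‖u.val x‖ₑ ^ 4 * (‖v.val x‖ₑ * ‖w.val x‖ₑ) ≤ C * ‖u‖ₑ ^ 4 * (‖v‖ₑ * ‖w‖ₑ) := by
  obtain ⟨C, hC⟩ := H1.exists_eLpNorm_six_le
  obtain ⟨D, hD⟩ := H1.exists_lintegral_mul_le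
  refine ⟨D * C ^ 4, fun u v w => ?_⟩
  have h := hD (fun x => ‖u.val x‖ₑ ^ (6 : ℝ)) v w
    (u.stronglyMeasurable_val.enorm.pow_const _).aemeasurable
  have h1 : ∀ x, (‖u.val x‖ₑ ^ (6 : ℝ)) ^ (2 / 3 : ℝ) = ‖u.val x‖ₑ ^ 4 := fun x => by
    rw [← ENNReal.rpow_mul, ← ENNReal.rpow_natCast]; norm_num
  have h2 : (∫⁻ x, ‖u.val x‖ₑ ^ (6 : ℝ)) ^ (2 / 3 : ℝ) = eLpNorm u.val 6 volume ^ 4 := by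
    rw [← lintegral_rpow_enorm_six, ← ENNReal.rpow_natCast, ← ENNReal.rpow_mul]; norm_num
  simp only [h1, h2] at h
  refine h.trans ?_
  push_cast
  calc (D : ℝ≥0∞) * eLpNorm u.val 6 volume ^ 4 * (‖v‖ₑ * ‖w‖ₑ)
      ≤ D * (C * ‖u‖ₑ) ^ 4 * (‖v‖ₑ * ‖w‖ₑ) := by
        gcongr
        exact hC u
    _ = _ := by ring

theorem integrable_and_integral_le_of_lintegral_enorm_le {f : R3 → ℝ}
    (hf : AEStronglyMeasurable f volume) {B : ℝ} (hB : 0 ≤ B)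
    (h : ∫⁻ x, ‖f x‖ₑ ≤ ENNReal.ofReal B) : Integrable f volume ∧ ∫ x, |f x| ≤ B := by
  have hi : Integrable f volume := ⟨hf, h.trans_lt ENNReal.ofReal_lt_top⟩
  refine ⟨hi, ?_⟩
  rw [← ofReal_integral_norm_eq_lintegral_enorm hi] at h
  exact (ENNReal.ofReal_le_ofReal_iff hB).1 h

/-- The growth estimate behind the differentiability of the power terms. -/
theorem H1.exists_integral_weight_le : ∃ K : ℝ, 0 ≤ K ∧ ∀ u v w : H1,
    Integrable (fun x => (1 + u.val x ^ 4) * (|v.val x| * |w.val x|)) volume ∧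
    ∫ x, (1 + u.val x ^ 4) * (|v.val x| * |w.val x|) ≤ K * (1 + ‖u‖ ^ 4) * (‖v‖ * ‖w‖) := by
  obtain ⟨C, hC⟩ := H1.exists_lintegral_quartic_mul_le
  refine ⟨1 + C, by positivity, fun u v w => ?_⟩
  have hn : ∀ x, 0 ≤ (1 + u.val x ^ 4) * (|v.val x| * |w.val x|) := fun x => by positivity
  have hm : AEStronglyMeasurable (fun x => (1 + u.val x ^ 4) * (|v.val x| * |w.val x|)) volume :=
    (((measurable_const.add (u.stronglyMeasurable_val.measurable.pow_const 4)).mul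
      (v.stronglyMeasurable_val.measurable.abs.mul
        w.stronglyMeasurable_val.measurable.abs))).aestronglyMeasurable
  have h := integrable_and_integral_le_of_lintegral_enorm_le hm
    (B := (1 + C) * (1 + ‖u‖ ^ 4) * (‖v‖ * ‖w‖)) (by positivity) (by
      have he : ∀ x, ‖(1 + u.val x ^ 4) * (|v.val x| * |w.val x|)‖ₑ
          = ‖v.val x‖ₑ * ‖w.val x‖ₑ + ‖u.val x‖ₑ ^ 4 * (‖v.val x‖ₑ * ‖w.val x‖ₑ) := by
        intro x
        have h4 : (0 : ℝ) ≤ u.val x ^ 4 := by positivity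
        have : ‖1 + u.val x ^ 4‖ₑ = 1 + ‖u.val x‖ₑ ^ 4 := by
          rw [Real.enorm_of_nonneg (by positivity), ENNReal.ofReal_add zero_le_one h4,
            ← Real.enorm_of_nonneg h4, enorm_pow, ENNReal.ofReal_one]
        rw [enorm_mul, this, enorm_mul, Real.enorm_abs, Real.enorm_abs, add_mul, one_mul]
      simp only [he]
      have hvw : Measurable fun x => ‖v.val x‖ₑ * ‖w.val x‖ₑ :=
        v.stronglyMeasurable_val.enorm.mul w.stronglyMeasurable_val.enorm
      rw [lintegral_add_left hvw]
      calc _ ≤ ‖v‖ₑ * ‖w‖ₑ + C * ‖u‖ₑ ^ 4 * (‖v‖ₑ * ‖w‖ₑ) :=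
            add_le_add (v.lintegral_enorm_mul_le w) (hC u v w)
        _ = ENNReal.ofReal (‖v‖ * ‖w‖ + C * ‖u‖ ^ 4 * (‖v‖ * ‖w‖)) := by
            rw [ENNReal.ofReal_add (by positivity) (by positivity),
              ENNReal.ofReal_mul (norm_nonneg v), ENNReal.ofReal_mul (by positivity),
              ENNReal.ofReal_mul (by positivity), ENNReal.ofReal_mul (norm_nonneg v),
              ENNReal.ofReal_pow (by positivity)]
            simp only [ofReal_norm, ENNReal.ofReal_coe_nnreal]
        _ ≤ _ := by
            apply ENNReal.ofReal_le_ofReal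
            have h1 : 0 ≤ ‖v‖ * ‖w‖ := by positivity
            have h2 : 0 ≤ ‖u‖ ^ 4 := by positivity
            have h3 : (0 : ℝ) ≤ C := C.coe_nonneg
            have h4 := mul_nonneg h1 h2
            nlinarith [mul_nonneg h3 h1])
  refine ⟨h.1, ?_⟩
  have h2 := h.2
  simp only [abs_of_nonneg (hn _)] at h2
  exact h2

end SchrodingerPoisson

/-! ### Differentiability of the power terms. -/

/-- A quadratic Taylor remainder identifies `D` as the derivative, and the second estimate makes `D`
locally Lipschitz. The factor `2 + ‖u‖⁴ + ‖v‖⁴` is the sum of the weights `1 + ‖u‖⁴` and `1 + ‖v‖⁴`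
produced by the Sobolev estimates. -/
theorem contDiff_one_of_quadratic_estimate {E : Type*} [NormedAddCommGroup E] [NormedSpace ℝ E]
    {F : E → ℝ} {D : E → E →L[ℝ] ℝ} {K : ℝ} (hK : 0 ≤ K)
    (hF : ∀ u v, |F (u + v) - F u - D u v| ≤ K * (2 + ‖u‖ ^ 4 + ‖v‖ ^ 4) * ‖v‖ ^ 2)
    (hD : ∀ u v w, |D (u + v) w - D u w| ≤ K * (2 + ‖u‖ ^ 4 + ‖v‖ ^ 4) * (‖v‖ * ‖w‖)) :
    ContDiff ℝ 1 F := by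
  refine contDiff_one_iff_hasFDerivAt.2 ⟨D, ?_, fun u => ?_⟩
  · refine continuous_iff_continuousAt.2 fun u => ?_
    have h0 : Tendsto (fun z => K * (2 + ‖u‖ ^ 4 + ‖z - u‖ ^ 4) * ‖z - u‖) (𝓝 u) (𝓝 0) := by
      have : Continuous fun z => K * (2 + ‖u‖ ^ 4 + ‖z - u‖ ^ 4) * ‖z - u‖ := by fun_prop
      simpa using this.tendsto u
    refine tendsto_iff_norm_sub_tendsto_zero.2
      (squeeze_zero (fun _ => norm_nonneg _) (fun z => ?_) h0)
    refine ContinuousLinearMap.opNorm_le_bound _ (by positivity) fun w => ?_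
    have := hD u (z - u) w
    rw [add_sub_cancel] at this
    rw [sub_apply, Real.norm_eq_abs]
    linarith
  · rw [hasFDerivAt_iff_isLittleO_nhds_zero]
    have hO : (fun v => F (u + v) - F u - D u v) =O[𝓝 0] fun v => ‖v‖ ^ 2 := by
      refine Asymptotics.IsBigO.of_bound (K * (2 + ‖u‖ ^ 4 + 1)) ?_
      filter_upwards [Metric.ball_mem_nhds (0 : E) one_pos] with v hv
      rw [mem_ball_zero_iff] at hv
      refine (hF u v).trans ?_
      rw [Real.norm_of_nonneg (by positivity)]
      gcongr
      exact pow_le_one₀ (norm_nonneg _) hv.le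
    refine hO.trans_isLittleO ?_
    simpa using Asymptotics.isLittleO_norm_pow_id (E' := E) one_lt_two

/-- Away from zero this is the usual power rule. Since `r > 1` the derivative extends continuously
through zero, and differentiability there follows. -/
theorem hasDerivAt_max_zero_rpow {r : ℝ} (hr : 1 < r) (s : ℝ) :
    HasDerivAt (fun s : ℝ => max s 0 ^ r) (r * max s 0 ^ (r - 1)) s := by
  refine hasDerivAt_of_hasDerivAt_of_ne' (x := 0) (f := fun s : ℝ => max s 0 ^ r)
    (g := fun s => r * max s 0 ^ (r - 1)) (fun s hs => ?_) ?_ ?_ s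
  · rcases lt_or_gt_of_ne hs with hs | hs
    · rw [max_eq_right hs.le, Real.zero_rpow (by linarith), mul_zero]
      refine (hasDerivAt_const s (0 : ℝ)).congr_of_eventuallyEq ?_
      filter_upwards [gt_mem_nhds hs] with x hx
      rw [max_eq_right hx.le, Real.zero_rpow (by linarith)]
    · rw [max_eq_left hs.le]
      refine (Real.hasDerivAt_rpow_const (Or.inl hs.ne')).congr_of_eventuallyEq ?_
      filter_upwards [lt_mem_nhds hs] with x hx
      rw [max_eq_left hx.le]
  · exact (Continuous.rpow_const (by fun_prop) fun _ => Or.inr (by linarith)).continuousAt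
  · exact (continuous_const.mul
      (Continuous.rpow_const (by fun_prop) fun _ => Or.inr (by linarith))).continuousAt

theorem max_zero_rpow_le {r : ℝ} (hr0 : 0 ≤ r) (hr4 : r ≤ 4) (s : ℝ) :
    max s 0 ^ r ≤ 1 + s ^ 4 := by
  have h0 : 0 ≤ max s 0 := le_max_right _ _
  have h4 : (0 : ℝ) ≤ s ^ 4 := by positivity
  rcases le_total (max s 0) 1 with h | h
  · have := Real.rpow_le_one h0 h hr0
    linarith
  · have h1 : max s 0 ^ r ≤ max s 0 ^ (4 : ℝ) := Real.rpow_le_rpow_of_exponent_le h hr4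
    have h2 : max s 0 ^ (4 : ℝ) ≤ s ^ 4 := by
      rw [show (4 : ℝ) = ((4 : ℕ) : ℝ) by norm_num, Real.rpow_natCast, ← Even.pow_abs (by decide) s]
      gcongr
      exact max_le (le_abs_self s) (abs_nonneg s)
    linarith

theorem max_zero_rpow_sub_le {q : ℝ} (hq2 : 2 < q) (hq6 : q ≤ 6) (s t : ℝ) :
    |max (s + t) 0 ^ (q - 1) - max s 0 ^ (q - 1)| ≤ 40 * ((1 + s ^ 4) + (1 + t ^ 4)) * |t| := by
  -- The constant is `5 · 8`: `q - 1 ≤ 5`, and `ξ⁴ ≤ 8 (s⁴ + t⁴)` by convexity of the fourth power.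
  have hbound : ∀ ξ ∈ Set.uIcc s (s + t), ‖(q - 1) * max ξ 0 ^ (q - 1 - 1)‖
      ≤ 40 * ((1 + s ^ 4) + (1 + t ^ 4)) := by
    intro ξ hξ
    have h1 : max ξ 0 ^ (q - 1 - 1) ≤ 1 + ξ ^ 4 :=
      max_zero_rpow_le (by linarith) (by linarith) ξ
    have h0 : 0 ≤ max ξ 0 ^ (q - 1 - 1) := Real.rpow_nonneg (le_max_right _ _) _
    have hd : |ξ - s| ≤ |t| := by
      simpa using Set.abs_sub_left_of_mem_uIcc hξ
    have h2 : ξ ^ 4 ≤ 8 * (s ^ 4 + t ^ 4) := by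
      have h3 : (ξ - s) ^ 4 ≤ t ^ 4 := by
        rw [← Even.pow_abs (by decide) (ξ - s), ← Even.pow_abs (by decide) t]
        gcongr
      have h4 : (s + (ξ - s)) ^ 4 ≤ 8 * (s ^ 4 + (ξ - s) ^ 4) := by
        have := Even.add_pow_le (n := 4) (by decide) (a := s) (b := ξ - s)
        norm_num at this
        linarith
      rw [add_sub_cancel] at h4
      linarith
    have h5 : (0 : ℝ) ≤ s ^ 4 := by positivity
    have h6 : (0 : ℝ) ≤ t ^ 4 := by positivity
    rw [norm_mul, Real.norm_of_nonneg h0, Real.norm_of_nonneg (by linarith)]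
    nlinarith
  have := (convex_uIcc s (s + t)).norm_image_sub_le_of_norm_hasDerivWithin_le
    (f := fun s : ℝ => max s 0 ^ (q - 1))
    (fun ξ _ => (hasDerivAt_max_zero_rpow (by linarith) ξ).hasDerivWithinAt) hbound
    Set.left_mem_uIcc Set.right_mem_uIcc
  simpa using this

theorem max_zero_rpow_taylor_le {q : ℝ} (hq2 : 2 < q) (hq6 : q ≤ 6) (s t : ℝ) :
    |max (s + t) 0 ^ q - max s 0 ^ q - q * max s 0 ^ (q - 1) * t|
      ≤ 240 * ((1 + s ^ 4) + (1 + t ^ 4)) * (|t| * |t|) := by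
  -- The mean value inequality is applied to the power minus its linear part at `s`; the constant is
  -- `240 = 6 · 40`, using `q ≤ 6`.
  have hbound : ∀ ξ ∈ Set.uIcc s (s + t), ‖q * max ξ 0 ^ (q - 1) - q * max s 0 ^ (q - 1)‖
      ≤ 240 * ((1 + s ^ 4) + (1 + t ^ 4)) * |t| := by
    intro ξ hξ
    have hd : |ξ - s| ≤ |t| := by
      simpa using Set.abs_sub_left_of_mem_uIcc hξ
    have h1 := max_zero_rpow_sub_le hq2 hq6 s (ξ - s)
    rw [add_sub_cancel] at h1
    have h3 : (ξ - s) ^ 4 ≤ t ^ 4 := by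
      rw [← Even.pow_abs (by decide) (ξ - s), ← Even.pow_abs (by decide) t]
      gcongr
    rw [← mul_sub, norm_mul, Real.norm_of_nonneg (by linarith), Real.norm_eq_abs]
    have h2 : |max ξ 0 ^ (q - 1) - max s 0 ^ (q - 1)|
        ≤ 40 * ((1 + s ^ 4) + (1 + t ^ 4)) * |t| := by
      refine h1.trans ?_
      gcongr
    calc q * |max ξ 0 ^ (q - 1) - max s 0 ^ (q - 1)|
        ≤ 6 * (40 * ((1 + s ^ 4) + (1 + t ^ 4)) * |t|) := by gcongr
      _ = _ := by ring
  have := (convex_uIcc s (s + t)).norm_image_sub_le_of_norm_hasDerivWithin_le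
    (f := fun ξ : ℝ => max ξ 0 ^ q - q * max s 0 ^ (q - 1) * ξ)
    (f' := fun ξ => q * max ξ 0 ^ (q - 1) - q * max s 0 ^ (q - 1))
    (fun ξ _ => by
      have h := (hasDerivAt_max_zero_rpow (r := q) (by linarith) ξ).sub
        ((hasDerivAt_id ξ).const_mul (q * max s 0 ^ (q - 1)))
      rw [mul_one] at h
      exact h.hasDerivWithinAt) hbound
    Set.left_mem_uIcc Set.right_mem_uIcc
  rw [Real.norm_eq_abs, Real.norm_eq_abs, add_sub_cancel_left, mul_assoc _ |t|] at this
  refine le_trans (le_of_eq ?_) this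
  congr 1
  ring

namespace SchrodingerPoisson

theorem measurable_max_zero_rpow (u : H1) (r : ℝ) :
    Measurable fun x => max (u.val x) 0 ^ r :=
  (u.stronglyMeasurable_val.measurable.max measurable_const).pow_const _

theorem max_zero_rpow_sub_one_le {q : ℝ} (hq2 : 2 < q) (hq6 : q ≤ 6) (s : ℝ) :
    max s 0 ^ (q - 1) ≤ (1 + s ^ 4) * |s| := by
  have h0 : 0 ≤ max s 0 := le_max_right _ _
  have h1 : max s 0 ^ (q - 1) = max s 0 ^ (q - 2) * max s 0 := by
    nth_rewrite 3 [← Real.rpow_one (max s 0)]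
    rw [← Real.rpow_add' h0 (by linarith)]
    ring_nf
  rw [h1]
  gcongr
  · exact max_zero_rpow_le (by linarith) (by linarith) s
  · exact max_le (le_abs_self s) (abs_nonneg s)

theorem max_zero_rpow_le_sq {q : ℝ} (hq2 : 2 < q) (hq6 : q ≤ 6) (s : ℝ) :
    max s 0 ^ q ≤ (1 + s ^ 4) * (|s| * |s|) := by
  have h0 : 0 ≤ max s 0 := le_max_right _ _
  have h1 : max s 0 ^ q = max s 0 ^ (q - 1) * max s 0 := by
    nth_rewrite 3 [← Real.rpow_one (max s 0)]
    rw [← Real.rpow_add' h0 (by linarith)]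
    ring_nf
  rw [h1, ← mul_assoc]
  gcongr
  · exact max_zero_rpow_sub_one_le hq2 hq6 s
  · exact max_le (le_abs_self s) (abs_nonneg s)

theorem integrable_posPow {q : ℝ} (hq2 : 2 < q) (hq6 : q ≤ 6) (u : H1) :
    Integrable (fun x => max (u.val x) 0 ^ q) volume := by
  obtain ⟨K, -, hK⟩ := H1.exists_integral_weight_le
  refine (hK u u u).1.mono' (measurable_max_zero_rpow u q).aestronglyMeasurable
    (ae_of_all _ fun x => ?_)
  rw [Real.norm_of_nonneg (Real.rpow_nonneg (le_max_right _ _) _)]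
  exact max_zero_rpow_le_sq hq2 hq6 _

theorem integrable_posPow_mul {q : ℝ} (hq2 : 2 < q) (hq6 : q ≤ 6) (u v : H1) :
    Integrable (fun x => q * max (u.val x) 0 ^ (q - 1) * v.val x) volume := by
  obtain ⟨K, -, hK⟩ := H1.exists_integral_weight_le
  refine ((hK u u v).1.const_mul q).mono' (((measurable_max_zero_rpow u (q - 1)).const_mul q).mul
    v.stronglyMeasurable_val.measurable).aestronglyMeasurable (ae_of_all _ fun x => ?_)
  rw [norm_mul, norm_mul, Real.norm_of_nonneg (Real.rpow_nonneg (le_max_right _ _) _),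
    Real.norm_of_nonneg (by linarith), mul_assoc, ← mul_assoc (1 + u.val x ^ 4), Real.norm_eq_abs]
  gcongr
  exact max_zero_rpow_sub_one_le hq2 hq6 _

theorem exists_posPowTerm_le : ∃ K : ℝ, 0 ≤ K ∧ ∀ q : ℝ, 2 < q → q ≤ 6 → ∀ u : H1,
    posPowTerm q u ≤ K * (1 + ‖u‖ ^ 4) * (‖u‖ * ‖u‖) := by
  obtain ⟨K, hK0, hK⟩ := H1.exists_integral_weight_le
  refine ⟨K, hK0, fun q hq2 hq6 u => le_trans ?_ (hK u u u).2⟩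
  exact integral_mono (integrable_posPow hq2 hq6 u) (hK u u u).1
    fun x => max_zero_rpow_le_sq hq2 hq6 _

/-- For `q ≤ 6` the second-order growth of the power is at most that of `1 + u⁴`, exactly the weight
that `H1.exists_integral_weight_le` can integrate against a product of two `H¹` functions.
Integrating the pointwise Taylor bounds gives the quadratic estimates. -/
theorem contDiff_posPowTerm {q : ℝ} (hq2 : 2 < q) (hq6 : q ≤ 6) : ContDiff ℝ 1 (posPowTerm q) := by
  obtain ⟨K, hK0, hK⟩ := H1.exists_integral_weight_le
  let D : H1 → H1 →L[ℝ] ℝ := fun u => LinearMap.mkContinuous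
    { toFun := fun v => ∫ x, q * max (u.val x) 0 ^ (q - 1) * v.val x
      map_add' := fun v w => by
        rw [← integral_add (integrable_posPow_mul hq2 hq6 u v)
          (integrable_posPow_mul hq2 hq6 u w)]
        refine integral_congr_ae ?_
        filter_upwards [H1.val_add v w] with x hx
        rw [hx]; ring
      map_smul' := fun c v => by
        rw [RingHom.id_apply, smul_eq_mul, ← integral_const_mul]
        refine integral_congr_ae ?_
        filter_upwards [H1.val_smul c v] with x hx
        rw [hx]; ring }
    (q * (K * (1 + ‖u‖ ^ 4) * ‖u‖)) (fun v => by
      change ‖∫ x, q * max (u.val x) 0 ^ (q - 1) * v.val x‖ ≤ _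
      have h1 : ‖∫ x, q * max (u.val x) 0 ^ (q - 1) * v.val x‖
          ≤ ∫ x, q * ((1 + u.val x ^ 4) * (|u.val x| * |v.val x|)) := by
        refine norm_integral_le_of_norm_le ((hK u u v).1.const_mul q) (ae_of_all _ fun x => ?_)
        rw [norm_mul, norm_mul, Real.norm_of_nonneg (Real.rpow_nonneg (le_max_right _ _) _),
          Real.norm_of_nonneg (by linarith), mul_assoc, ← mul_assoc (1 + u.val x ^ 4),
          Real.norm_eq_abs]
        gcongr
        exact max_zero_rpow_sub_one_le hq2 hq6 _
      rw [integral_const_mul] at h1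
      refine h1.trans ?_
      rw [mul_assoc, mul_assoc]
      gcongr
      have := (hK u u v).2
      linarith)
  refine contDiff_one_of_quadratic_estimate (D := D) (K := 240 * K) (by positivity) ?_ ?_
  · intro u v
    have hI := (((hK u v v).1.add (hK v v v).1).const_mul 240)
    have hv : ∀ᵐ x, ‖max ((u + v).val x) 0 ^ q - max (u.val x) 0 ^ q
        - q * max (u.val x) 0 ^ (q - 1) * v.val x‖ ≤ 240 * ((1 + u.val x ^ 4) *
        (|v.val x| * |v.val x|) + (1 + v.val x ^ 4) * (|v.val x| * |v.val x|)) := by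
      filter_upwards [H1.val_add u v] with x hx
      rw [hx]
      refine (max_zero_rpow_taylor_le hq2 hq6 _ _).trans (le_of_eq ?_)
      ring
    have h1 := norm_integral_le_of_norm_le hI hv
    have hsub : Integrable (fun x => max ((u + v).val x) 0 ^ q - max (u.val x) 0 ^ q) volume :=
      (integrable_posPow hq2 hq6 _).sub (integrable_posPow hq2 hq6 _)
    rw [integral_sub hsub (integrable_posPow_mul hq2 hq6 u v),
      integral_sub (integrable_posPow hq2 hq6 _) (integrable_posPow hq2 hq6 _)] at h1
    refine h1.trans ?_
    simp only [Pi.add_apply]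
    rw [integral_const_mul, integral_add (hK u v v).1 (hK v v v).1]
    have h2 := (hK u v v).2
    have h3 := (hK v v v).2
    rw [mul_assoc, mul_assoc]
    nlinarith
  · intro u v w
    have hI := (((hK u v w).1.add (hK v v w).1).const_mul 240)
    have hv : ∀ᵐ x, ‖q * max ((u + v).val x) 0 ^ (q - 1) * w.val x
        - q * max (u.val x) 0 ^ (q - 1) * w.val x‖ ≤ 240 * ((1 + u.val x ^ 4) *
        (|v.val x| * |w.val x|) + (1 + v.val x ^ 4) * (|v.val x| * |w.val x|)) := by
      filter_upwards [H1.val_add u v] with x hx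
      rw [hx, ← sub_mul, ← mul_sub, norm_mul, norm_mul, Real.norm_of_nonneg (by linarith),
        Real.norm_eq_abs, Real.norm_eq_abs]
      calc q * |max (u.val x + v.val x) 0 ^ (q - 1) - max (u.val x) 0 ^ (q - 1)| * |w.val x|
          ≤ 6 * (40 * ((1 + u.val x ^ 4) + (1 + v.val x ^ 4)) * |v.val x|) * |w.val x| := by
            gcongr
            exact max_zero_rpow_sub_le hq2 hq6 _ _
        _ = _ := by ring
    have h1 := norm_integral_le_of_norm_le hI hv
    rw [integral_sub (integrable_posPow_mul hq2 hq6 _ _)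
      (integrable_posPow_mul hq2 hq6 u w)] at h1
    refine h1.trans ?_
    simp only [Pi.add_apply]
    rw [integral_const_mul, integral_add (hK u v w).1 (hK v v w).1]
    have h2 := (hK u v w).2
    have h3 := (hK v v w).2
    rw [mul_assoc, mul_assoc]
    nlinarith

end SchrodingerPoisson

/-! ### Differentiability of the Poisson term. -/

theorem contDiff_diagonal_of_bilinear {E G : Type*} [NormedAddCommGroup E] [NormedSpace ℝ E]
    [NormedAddCommGroup G] [NormedSpace ℝ G] (A : E →ₗ[ℝ] E →ₗ[ℝ] G) {K : ℝ}
    (hK : ∀ u v, ‖A u v‖ ≤ K * ‖u‖ * ‖v‖) : ContDiff ℝ 1 fun u => A u u := by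
  have h1 : ContDiff ℝ 1 fun u => A.mkContinuous₂ K hK u := (A.mkContinuous₂ K hK).contDiff
  exact h1.clm_apply contDiff_id

/-- The form is read as a bounded bilinear map in the first pair with values in bounded bilinear
forms in the second pair. Symmetry within each pair supplies linearity in the second and fourth
slots. -/
theorem contDiff_diagonal_of_quadrilinear {E : Type*} [NormedAddCommGroup E] [NormedSpace ℝ E]
    {f : E → E → E → E → ℝ} {K : ℝ} (hK0 : 0 ≤ K)
    (hcl : ∀ u v w z, f u v w z = f v u w z) (hcr : ∀ u v w z, f u v w z = f u v z w)
    (hadd1 : ∀ u u' v w z, f (u + u') v w z = f u v w z + f u' v w z)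
    (hsmul1 : ∀ (c : ℝ) u v w z, f (c • u) v w z = c * f u v w z)
    (hadd3 : ∀ u v w w' z, f u v (w + w') z = f u v w z + f u v w' z)
    (hsmul3 : ∀ (c : ℝ) u v w z, f u v (c • w) z = c * f u v w z)
    (hK : ∀ u v w z, |f u v w z| ≤ K * ‖u‖ * ‖v‖ * ‖w‖ * ‖z‖) :
    ContDiff ℝ 1 fun u => f u u u u := by
  let A : E → E → E →L[ℝ] E →L[ℝ] ℝ := fun u v =>
    LinearMap.mkContinuous₂ (LinearMap.mk₂ ℝ (f u v) (hadd3 u v) (fun c w z => hsmul3 c u v w z)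
      (fun w z z' => by simp only [hcr u v w, hadd3])
      (fun c w z => by simp only [hcr u v w, hsmul3, smul_eq_mul]))
      (K * ‖u‖ * ‖v‖) (fun w z => hK u v w z)
  have hA : ∀ u v w z, A u v w z = f u v w z := fun _ _ _ _ => rfl
  have h1 : ContDiff ℝ 1 fun u => A u u :=
    contDiff_diagonal_of_bilinear (LinearMap.mk₂ ℝ A
      (fun u u' v => by ext w z; simp [hA, hadd1])
      (fun c u v => by ext w z; simp [hA, hsmul1])
      (fun u v v' => by ext w z; simp [hA, hcl u, hadd1])
      (fun c u v => by ext w z; simp [hA, hcl u, hsmul1]))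
      (fun u v => LinearMap.mkContinuous₂_norm_le _ (by positivity) (fun w z => hK u v w z))
  have h2 : ContDiff ℝ 1 fun u => A u u u := h1.clm_apply contDiff_id
  exact h2.clm_apply contDiff_id

namespace SchrodingerPoisson

/-- The `3/2`-power of the Newton kernel, cut off to the unit ball, has finite integral. -/
theorem lintegral_newton_kernel_lt_top :
    ∫⁻ z : R3, (Metric.ball (0 : R3) 1).indicator (fun z => ‖‖z‖⁻¹‖ₑ ^ (3 / 2 : ℝ)) z < ⊤ := by
  have hm : Measurable fun z : R3 => ‖z‖⁻¹ ^ (3 / 2 : ℝ) := by fun_prop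
  have h : IntegrableOn (fun z : R3 => ‖z‖⁻¹ ^ (3 / 2 : ℝ)) (Metric.ball 0 1) volume := by
    refine integrableOn_ball_of_norm_le_rpow (C := 1) (α := 3 / 2) (by simp) (by norm_num)
      (ae_of_all _ fun z => ?_) hm.aestronglyMeasurable
    rw [Real.norm_of_nonneg (by positivity), one_mul, Real.inv_rpow (norm_nonneg _),
      Real.rpow_neg (norm_nonneg _)]
  have h2 := h.2
  rw [lintegral_indicator Metric.isOpen_ball.measurableSet]
  refine lt_of_le_of_lt (le_of_eq (lintegral_congr fun z => ?_)) h2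
  rw [Real.enorm_rpow_of_nonneg (by positivity) (by norm_num)]

/-- Inside the unit ball around `x` the kernel is in `L^{3/2}` and is paired with two `L⁶`
functions; outside it is at most one and the `L²` bound suffices. Translation invariance makes the
constant independent of `x`. -/
theorem H1.exists_lintegral_newton_le : ∃ C : NNReal, ∀ (u v : H1) (x : R3),
    ∫⁻ y, ‖u.val y * v.val y / ‖x - y‖‖ₑ ≤ C * (‖u‖ₑ * ‖v‖ₑ) := by
  obtain ⟨D, hD⟩ := H1.exists_lintegral_mul_le
  set I := ∫⁻ z : R3, (Metric.ball (0 : R3) 1).indicator (fun z => ‖‖z‖⁻¹‖ₑ ^ (3 / 2 : ℝ)) z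
  have hIt : I ^ (2 / 3 : ℝ) ≠ ⊤ :=
    ENNReal.rpow_ne_top_of_nonneg (by norm_num) lintegral_newton_kernel_lt_top.ne
  refine ⟨D * (I ^ (2 / 3 : ℝ)).toNNReal + 1, fun u v x => ?_⟩
  let k : R3 → ℝ≥0∞ := (Metric.ball (0 : R3) 1).indicator (fun z => ‖‖z‖⁻¹‖ₑ ^ (3 / 2 : ℝ))
  have hk : Measurable k := by
    refine Measurable.indicator ?_ Metric.isOpen_ball.measurableSet
    fun_prop
  have hkx : Measurable fun y => k (x - y) := hk.comp (measurable_const.sub measurable_id)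
  have hkI : ∫⁻ y, k (x - y) = I := lintegral_sub_left_eq_self k x
  have hpt : ∀ y, ‖u.val y * v.val y / ‖x - y‖‖ₑ
      ≤ k (x - y) ^ (2 / 3 : ℝ) * (‖u.val y‖ₑ * ‖v.val y‖ₑ) + ‖u.val y‖ₑ * ‖v.val y‖ₑ := by
    intro y
    rw [div_eq_mul_inv, enorm_mul, enorm_mul, mul_comm]
    by_cases hxy : x - y ∈ Metric.ball (0 : R3) 1
    · have h1 : k (x - y) ^ (2 / 3 : ℝ) = ‖‖x - y‖⁻¹‖ₑ := by
        simp only [k, Set.indicator_of_mem hxy]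
        rw [← ENNReal.rpow_mul]; norm_num
      rw [h1]
      exact le_self_add
    · have h1 : ‖‖x - y‖⁻¹‖ₑ ≤ 1 := by
        have h2 : 1 ≤ ‖x - y‖ := by simpa using hxy
        rw [Real.enorm_of_nonneg (by positivity), ← ENNReal.ofReal_one]
        exact ENNReal.ofReal_le_ofReal (inv_le_one_of_one_le₀ h2)
      exact (mul_le_of_le_one_left' h1).trans le_add_self
  have hm : Measurable fun y => ‖u.val y‖ₑ * ‖v.val y‖ₑ :=
    u.stronglyMeasurable_val.enorm.mul v.stronglyMeasurable_val.enorm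
  refine (lintegral_mono hpt).trans ?_
  rw [lintegral_add_right _ hm]
  refine (add_le_add (hD _ u v hkx.aemeasurable) (u.lintegral_enorm_mul_le v)).trans ?_
  rw [hkI]
  push_cast
  rw [ENNReal.coe_toNNReal hIt, add_mul, one_mul]

/-- The polarized Newton potential `∫ u(y) v(y) / |x - y| dy`. -/
noncomputable def newtonPotential (u v : H1) (x : R3) : ℝ := ∫ y, u.val y * v.val y / ‖x - y‖

theorem newton_bound : ∃ K : ℝ, 0 ≤ K ∧ ∀ (u v : H1) (x : R3),
    Integrable (fun y => u.val y * v.val y / ‖x - y‖) volume ∧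
    |newtonPotential u v x| ≤ K * (‖u‖ * ‖v‖) := by
  obtain ⟨C, hC⟩ := H1.exists_lintegral_newton_le
  refine ⟨C, C.coe_nonneg, fun u v x => ?_⟩
  have hm : Measurable fun y => u.val y * v.val y / ‖x - y‖ :=
    (u.stronglyMeasurable_val.measurable.mul v.stronglyMeasurable_val.measurable).div
      (measurable_const.sub measurable_id).norm
  have h := integrable_and_integral_le_of_lintegral_enorm_le hm.aestronglyMeasurable
    (B := C * (‖u‖ * ‖v‖)) (by positivity) ((hC u v x).trans (le_of_eq (by
      rw [ENNReal.ofReal_mul C.coe_nonneg, ENNReal.ofReal_mul (norm_nonneg u), ofReal_norm,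
        ofReal_norm, ENNReal.ofReal_coe_nnreal])))
  exact ⟨h.1, (norm_integral_le_integral_norm fun y => u.val y * v.val y / ‖x - y‖).trans h.2⟩

theorem integrable_newton (u v : H1) (x : R3) :
    Integrable (fun y => u.val y * v.val y / ‖x - y‖) volume := by
  obtain ⟨K, -, hK⟩ := newton_bound
  exact (hK u v x).1

theorem newtonPotential_comm (u v : H1) : newtonPotential u v = newtonPotential v u := by
  ext x
  simp only [newtonPotential, mul_comm]

theorem newtonPotential_add_left (u u' v : H1) (x : R3) :
    newtonPotential (u + u') v x = newtonPotential u v x + newtonPotential u' v x := by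
  simp only [newtonPotential]
  rw [← integral_add (integrable_newton u v x) (integrable_newton u' v x)]
  refine integral_congr_ae ?_
  filter_upwards [H1.val_add u u'] with y hy
  rw [hy]; ring

theorem newtonPotential_smul_left (c : ℝ) (u v : H1) (x : R3) :
    newtonPotential (c • u) v x = c * newtonPotential u v x := by
  simp only [newtonPotential]
  rw [← integral_const_mul]
  refine integral_congr_ae ?_
  filter_upwards [H1.val_smul c u] with y hy
  rw [hy]; ring

theorem stronglyMeasurable_newtonPotential (u v : H1) :
    StronglyMeasurable (newtonPotential u v) := by
  have h : Measurable fun z : R3 × R3 => u.val z.2 * v.val z.2 / ‖z.1 - z.2‖ :=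
    ((u.stronglyMeasurable_val.measurable.comp measurable_snd).mul
      (v.stronglyMeasurable_val.measurable.comp measurable_snd)).div
      (measurable_fst.sub measurable_snd).norm
  exact h.stronglyMeasurable.integral_prod_right'

theorem integrable_newtonPotential_mul (u v w z : H1) :
    Integrable (fun x => newtonPotential u v x * (w.val x * z.val x)) volume := by
  obtain ⟨K, -, hK⟩ := newton_bound
  exact (w.integrable_mul z).bdd_mul (stronglyMeasurable_newtonPotential u v).aestronglyMeasurable
    (ae_of_all _ fun x => (hK u v x).2)

/-- The quadrilinear form `∬ u(y) v(y) w(x) z(x) / |x - y| dy dx`. -/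
noncomputable def newtonForm (u v w z : H1) : ℝ :=
  ∫ x, newtonPotential u v x * (w.val x * z.val x)

theorem newtonForm_comm_left (u v w z : H1) : newtonForm u v w z = newtonForm v u w z := by
  simp only [newtonForm, newtonPotential_comm u v]

theorem newtonForm_comm_right (u v w z : H1) : newtonForm u v w z = newtonForm u v z w := by
  simp only [newtonForm, mul_comm (w.val _)]

theorem newtonForm_add_one (u u' v w z : H1) :
    newtonForm (u + u') v w z = newtonForm u v w z + newtonForm u' v w z := by
  simp only [newtonForm, newtonPotential_add_left, add_mul]
  exact integral_add (integrable_newtonPotential_mul _ _ _ _)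
    (integrable_newtonPotential_mul _ _ _ _)

theorem newtonForm_smul_one (c : ℝ) (u v w z : H1) :
    newtonForm (c • u) v w z = c * newtonForm u v w z := by
  simp only [newtonForm, newtonPotential_smul_left, mul_assoc, integral_const_mul]

theorem newtonForm_add_three (u v w w' z : H1) :
    newtonForm u v (w + w') z = newtonForm u v w z + newtonForm u v w' z := by
  simp only [newtonForm]
  rw [← integral_add (integrable_newtonPotential_mul _ _ _ _)
    (integrable_newtonPotential_mul _ _ _ _)]
  refine integral_congr_ae ?_
  filter_upwards [H1.val_add w w'] with y hy
  rw [hy]; ring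

theorem newtonForm_smul_three (c : ℝ) (u v w z : H1) :
    newtonForm u v (c • w) z = c * newtonForm u v w z := by
  simp only [newtonForm]
  rw [← integral_const_mul]
  refine integral_congr_ae ?_
  filter_upwards [H1.val_smul c w] with y hy
  rw [hy]; ring

theorem exists_newtonForm_le : ∃ K : ℝ, 0 ≤ K ∧ ∀ u v w z : H1,
    |newtonForm u v w z| ≤ K * ‖u‖ * ‖v‖ * ‖w‖ * ‖z‖ := by
  obtain ⟨K, hK0, hK⟩ := newton_bound
  refine ⟨K, hK0, fun u v w z => ?_⟩
  have h1 : ‖∫ x, newtonPotential u v x * (w.val x * z.val x)‖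
      ≤ ∫ x, K * (‖u‖ * ‖v‖) * (|w.val x| * |z.val x|) := by
    have hi : Integrable (fun x => |w.val x| * |z.val x|) volume := by
      simpa [abs_mul] using (w.integrable_mul z).abs
    refine norm_integral_le_of_norm_le (hi.const_mul _) (ae_of_all _ fun x => ?_)
    rw [norm_mul, norm_mul, Real.norm_eq_abs, Real.norm_eq_abs, Real.norm_eq_abs]
    gcongr
    exact (hK u v x).2
  rw [integral_const_mul] at h1
  refine h1.trans ?_
  calc K * (‖u‖ * ‖v‖) * ∫ x, |w.val x| * |z.val x|
      ≤ K * (‖u‖ * ‖v‖) * (‖w‖ * ‖z‖) := by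
        gcongr
        exact w.integral_abs_mul_le z
    _ = _ := by ring

theorem poissonTerm_eq (u : H1) : poissonTerm u = 1 / (4 * Real.pi) * newtonForm u u u u := by
  rw [poissonTerm, newtonForm, ← integral_const_mul]
  refine integral_congr_ae (ae_of_all _ fun x => ?_)
  simp only [poissonPotential, newtonPotential, sq, mul_assoc]

theorem contDiff_poissonTerm : ContDiff ℝ 1 poissonTerm := by
  obtain ⟨K, hK0, hK⟩ := exists_newtonForm_le
  rw [funext poissonTerm_eq]
  exact contDiff_const.mul (contDiff_diagonal_of_quadrilinear hK0 newtonForm_comm_left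
    newtonForm_comm_right newtonForm_add_one newtonForm_smul_one newtonForm_add_three
    newtonForm_smul_three hK)

theorem poissonTerm_nonneg (u : H1) : 0 ≤ poissonTerm u := by
  refine integral_nonneg fun x => mul_nonneg (mul_nonneg (by positivity)
    (integral_nonneg fun y => ?_)) (sq_nonneg _)
  change 0 ≤ u.val y ^ 2 / ‖x - y‖
  positivity

/-! ### The energy, its derivative along rays, and boundedness. -/

theorem contDiff_energy {a lam p : ℝ} (hp2 : 2 < p) (hp6 : p ≤ 6) :
    ContDiff ℝ 1 (energy a lam p) := by
  unfold energy
  have h1 := contDiff_gradTerm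
  have h2 := contDiff_massTerm
  have h3 := contDiff_poissonTerm
  have h4 := contDiff_posPowTerm hp2 hp6
  have h5 := contDiff_posPowTerm (q := 6) (by norm_num) le_rfl
  fun_prop

theorem gradTerm_nonneg (u : H1) : 0 ≤ gradTerm u := by rw [gradTerm_eq]; positivity

theorem massTerm_nonneg (u : H1) : 0 ≤ massTerm u := by rw [massTerm_eq]; positivity

theorem posPowTerm_nonneg (q : ℝ) (u : H1) : 0 ≤ posPowTerm q u :=
  integral_nonneg fun _ => Real.rpow_nonneg (le_max_right _ _) _

theorem gradTerm_smul (c : ℝ) (u : H1) : gradTerm (c • u) = c ^ 2 * gradTerm u := by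
  rw [gradTerm_eq, gradTerm_eq, map_smul, norm_smul, mul_pow, Real.norm_eq_abs, sq_abs]

theorem massTerm_smul (c : ℝ) (u : H1) : massTerm (c • u) = c ^ 2 * massTerm u := by
  rw [massTerm_eq, massTerm_eq, map_smul, norm_smul, mul_pow, Real.norm_eq_abs, sq_abs]

theorem poissonTerm_smul (c : ℝ) (u : H1) : poissonTerm (c • u) = c ^ 4 * poissonTerm u := by
  rw [poissonTerm_eq, poissonTerm_eq, newtonForm_smul_one, newtonForm_comm_left,
    newtonForm_smul_one, newtonForm_smul_three, newtonForm_comm_right, newtonForm_smul_three]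
  ring

theorem posPowTerm_smul (q : ℝ) {c : ℝ} (hc : 0 ≤ c) (u : H1) :
    posPowTerm q (c • u) = c ^ q * posPowTerm q u := by
  rw [posPowTerm, posPowTerm, ← integral_const_mul]
  refine integral_congr_ae ?_
  filter_upwards [H1.val_smul c u] with x hx
  rw [hx, ← Real.mul_rpow hc (le_max_right _ _), mul_max_of_nonneg _ _ hc, mul_zero]

theorem energy_smul (a lam p : ℝ) {c : ℝ} (hc : 0 ≤ c) (u : H1) :
    energy a lam p (c • u) = 1 / 2 * (c ^ 2 * gradTerm u) + a / 2 * (c ^ 2 * massTerm u)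
      + 1 / 4 * (c ^ 4 * poissonTerm u) - lam / p * (c ^ p * posPowTerm p u)
      - 1 / 6 * (c ^ (6 : ℝ) * posPowTerm 6 u) := by
  rw [energy, gradTerm_smul, massTerm_smul, poissonTerm_smul, posPowTerm_smul _ hc,
    posPowTerm_smul _ hc]

/-- The pairing with `u` is the derivative of `c ↦ I_a(c u)` at `c = 1`, and every term is
homogeneous in `c`. -/
theorem fderiv_energy_apply_self {a lam p : ℝ} (hp2 : 2 < p) (hp6 : p ≤ 6) (u : H1) :
    fderiv ℝ (energy a lam p) u u = gradTerm u + a * massTerm u + poissonTerm u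
      - lam * posPowTerm p u - posPowTerm 6 u := by
  have hd : HasFDerivAt (energy a lam p) (fderiv ℝ (energy a lam p) u) ((1 : ℝ) • u) := by
    rw [one_smul]
    exact ((contDiff_energy hp2 hp6).differentiable one_ne_zero u).hasFDerivAt
  have h1 : HasDerivAt (fun c : ℝ => energy a lam p (c • u)) (fderiv ℝ (energy a lam p) u u) 1 := by
    have h := hd.comp_hasDerivAt (1 : ℝ) ((hasDerivAt_id (1 : ℝ)).smul_const u)
    rw [one_smul] at h
    exact h
  have h2 : HasDerivAt (fun c : ℝ => 1 / 2 * (c ^ 2 * gradTerm u) + a / 2 * (c ^ 2 * massTerm u)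
      + 1 / 4 * (c ^ 4 * poissonTerm u) - lam / p * (c ^ p * posPowTerm p u)
      - 1 / 6 * (c ^ (6 : ℝ) * posPowTerm 6 u)) (gradTerm u + a * massTerm u + poissonTerm u
      - lam * posPowTerm p u - posPowTerm 6 u) 1 := by
    have e2 : HasDerivAt (fun c : ℝ => c ^ 2) 2 1 := by simpa using hasDerivAt_pow 2 (1 : ℝ)
    have e4 : HasDerivAt (fun c : ℝ => c ^ 4) 4 1 := by simpa using hasDerivAt_pow 4 (1 : ℝ)
    have ep : HasDerivAt (fun c : ℝ => c ^ p) p 1 := by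
      simpa using Real.hasDerivAt_rpow_const (x := 1) (p := p) (Or.inl one_ne_zero)
    have e6 : HasDerivAt (fun c : ℝ => c ^ (6 : ℝ)) 6 1 := by
      simpa using Real.hasDerivAt_rpow_const (x := 1) (p := 6) (Or.inl one_ne_zero)
    refine ((((((e2.mul_const (gradTerm u)).const_mul (1 / 2)).add
      ((e2.mul_const (massTerm u)).const_mul (a / 2))).add
      ((e4.mul_const (poissonTerm u)).const_mul (1 / 4))).sub
      ((ep.mul_const (posPowTerm p u)).const_mul (lam / p))).sub
      ((e6.mul_const (posPowTerm 6 u)).const_mul (1 / 6))).congr_deriv ?_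
    have : p ≠ 0 := by linarith
    field_simp
  -- Homogeneity of the positive part needs `c ≥ 0`, so the two functions of `c` are compared only
  -- near `1`.
  refine h1.unique (h2.congr_of_eventuallyEq ?_)
  filter_upwards [lt_mem_nhds (zero_lt_one (α := ℝ))] with c hc
  exact energy_smul a lam p hc.le u

theorem nehariPohozaev_eq {a lam p : ℝ} (hp2 : 2 < p) (hp6 : p ≤ 6) (u : H1) :
    nehariPohozaev a lam p u = 2 * fderiv ℝ (energy a lam p) u u - pohozaev a lam p u := by
  rw [fderiv_energy_apply_self hp2 hp6, nehariPohozaev, pohozaev]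
  have : p ≠ 0 := by linarith
  field_simp
  ring

/-- Subtracting `G_a / (2p - 3)` from the energy removes the `p`-power term. With `r = 1 / (2p -
3)`, the gradient and Poisson coefficients need `r < 1/3`, that is `p > 3`, and the sixth-power one
needs `r ≥ 1/9`, for which `p ≤ 4` gives `r ≥ 1/5`. -/
theorem bounded_of_tendsto {a lam p : ℝ} (ha : 0 < a) (hp3 : 3 < p) (hp4 : p ≤ 4) {c : ℝ}
    {u : ℕ → H1} (hI : Tendsto (fun n => energy a lam p (u n)) atTop (𝓝 c))
    (hG : Tendsto (fun n => nehariPohozaev a lam p (u n)) atTop (𝓝 0)) :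
    ∃ C : ℝ, ∀ n, ‖u n‖ ≤ C := by
  obtain ⟨B, hB⟩ := (hI.sub (hG.div_const (2 * p - 3))).bddAbove_range
  have hq : 3 < 2 * p - 3 := by linarith
  have hinv : (2 * p - 3)⁻¹ < 3⁻¹ := inv_strictAnti₀ (by norm_num) hq
  have hinv0 : 0 < (2 * p - 3)⁻¹ := by positivity
  have hinv5 : 5⁻¹ ≤ (2 * p - 3)⁻¹ := inv_anti₀ (by linarith) (by linarith)
  set r := (2 * p - 3)⁻¹ with hr
  set κ := min (1 / 2 - 3 / 2 * r) (a / 2 * (1 - r)) with hκ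
  have hκ0 : 0 < κ := lt_min (by linarith) (mul_pos (by linarith) (by linarith))
  refine ⟨Real.sqrt (B / κ), fun n => Real.le_sqrt_of_sq_le ?_⟩
  rw [le_div_iff₀ hκ0]
  have h1 : energy a lam p (u n) - nehariPohozaev a lam p (u n) / (2 * p - 3) ≤ B :=
    hB ⟨n, rfl⟩
  have h2 : energy a lam p (u n) - nehariPohozaev a lam p (u n) / (2 * p - 3)
      = (1 / 2 - 3 / 2 * r) * gradTerm (u n) + a / 2 * (1 - r) * massTerm (u n)
        + (1 / 4 - 3 / 4 * r) * poissonTerm (u n) + (3 / 2 * r - 1 / 6) * posPowTerm 6 (u n) := by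
    have h3 : (2 * p - 3) * r = 1 := mul_inv_cancel₀ (by linarith)
    rw [div_eq_mul_inv, ← hr, energy, nehariPohozaev]
    linear_combination (lam / p * posPowTerm p (u n)) * h3
  rw [h2] at h1
  rw [norm_sq_eq_gradTerm_add_massTerm]
  have h4 := mul_le_mul_of_nonneg_right (min_le_left (1 / 2 - 3 / 2 * r) (a / 2 * (1 - r)))
    (gradTerm_nonneg (u n))
  have h5 := mul_le_mul_of_nonneg_right (min_le_right (1 / 2 - 3 / 2 * r) (a / 2 * (1 - r)))
    (massTerm_nonneg (u n))
  rw [← hκ] at h4 h5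
  have h6 : 0 ≤ (1 / 4 - 3 / 4 * r) * poissonTerm (u n) :=
    mul_nonneg (by linarith) (poissonTerm_nonneg _)
  have h7 : 0 ≤ (3 / 2 * r - 1 / 6) * posPowTerm 6 (u n) :=
    mul_nonneg (by linarith) (posPowTerm_nonneg _ _)
  linarith

/-! ### Mountain pass geometry. -/

/-- Homogeneity reduces the claim to the unit sphere, where the inhomogeneous bound is a constant.
-/
theorem exists_posPowTerm_le_rpow : ∃ K : ℝ, 0 ≤ K ∧ ∀ q : ℝ, 2 < q → q ≤ 6 → ∀ u : H1,
    posPowTerm q u ≤ K * ‖u‖ ^ q := by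
  obtain ⟨K, hK0, hK⟩ := exists_posPowTerm_le
  refine ⟨K * 2, by positivity, fun q hq2 hq6 u => ?_⟩
  rcases eq_or_ne u 0 with rfl | hu
  · have := hK q hq2 hq6 0
    simp only [norm_zero, mul_zero] at this
    rw [norm_zero, Real.zero_rpow (by linarith), mul_zero]
    exact this
  · have hn : ‖u‖ ≠ 0 := norm_ne_zero_iff.2 hu
    have h1 : u = ‖u‖ • (‖u‖⁻¹ • u) := by rw [smul_smul, mul_inv_cancel₀ hn, one_smul]
    have h2 := hK q hq2 hq6 (‖u‖⁻¹ • u)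
    rw [norm_smul, norm_inv, norm_norm, inv_mul_cancel₀ hn] at h2
    calc posPowTerm q u = ‖u‖ ^ q * posPowTerm q (‖u‖⁻¹ • u) := by
          conv_lhs => rw [h1]
          exact posPowTerm_smul q (norm_nonneg _) _
      _ ≤ ‖u‖ ^ q * (K * 2) := by
          gcongr
          linarith
      _ = _ := mul_comm _ _

/-- Mountain pass geometry near the origin. -/
theorem exists_energy_pos_sphere {a lam p : ℝ} (ha : 0 < a) (hlam : 0 < lam) (hp3 : 3 < p)
    (hp4 : p ≤ 4) : ∃ ρ α : ℝ, 0 < ρ ∧ 0 < α ∧ (∀ u : H1, ‖u‖ = ρ → α ≤ energy a lam p u) ∧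
      ∀ u : H1, ‖u‖ ≤ ρ → 0 ≤ energy a lam p u := by
  obtain ⟨K, hK0, hK⟩ := exists_posPowTerm_le_rpow
  set k := min 1 a / 2 with hk
  have hk0 : 0 < k := half_pos (lt_min one_pos ha)
  -- The added `1` keeps `M` positive even if `K = 0`, since `ρ` is defined by dividing by `M`.
  set M := (lam / p + 1 / 6) * K + 1 with hM
  have hM0 : 0 < M := by positivity
  have hmain : ∀ u : H1, ‖u‖ ≤ 1 → ‖u‖ ^ 2 * (k - M * ‖u‖) ≤ energy a lam p u := by
    intro u hu
    -- In the unit ball every power of exponent at least three is dominated by the cube, so both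
    -- nonlinear terms are handled at once.
    have hq : ∀ q : ℝ, 3 ≤ q → q ≤ 6 → posPowTerm q u ≤ K * ‖u‖ ^ 3 := by
      intro q hq3 hq6
      refine (hK q (by linarith) hq6 u).trans ?_
      gcongr
      rw [← Real.rpow_natCast]
      exact Real.rpow_le_rpow_of_exponent_ge' (norm_nonneg _) hu (by norm_num) (by simpa using hq3)
    have h1 := mul_le_mul_of_nonneg_left (hq p hp3.le (by linarith))
      (by positivity : 0 ≤ lam / p)
    have h2 := hq 6 (by norm_num) le_rfl
    have h3 : k * ‖u‖ ^ 2 ≤ 1 / 2 * gradTerm u + a / 2 * massTerm u := by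
      rw [norm_sq_eq_gradTerm_add_massTerm]
      have h4 := mul_le_mul_of_nonneg_right (min_le_left 1 a) (gradTerm_nonneg u)
      have h5 := mul_le_mul_of_nonneg_right (min_le_right 1 a) (massTerm_nonneg u)
      rw [hk]
      linarith
    have h6 := poissonTerm_nonneg u
    have h7 : 0 ≤ ‖u‖ ^ 3 := by positivity
    rw [energy]
    have h8 : ‖u‖ ^ 2 * (k - M * ‖u‖) = k * ‖u‖ ^ 2 - lam / p * (K * ‖u‖ ^ 3)
        - 1 / 6 * (K * ‖u‖ ^ 3) - ‖u‖ ^ 3 := by rw [hM]; ring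
    linarith
  set ρ := min 1 (k / (2 * M)) with hρ
  have hρ0 : 0 < ρ := lt_min one_pos (by positivity)
  have hρM : M * ρ ≤ k / 2 := by
    have : ρ ≤ k / (2 * M) := min_le_right _ _
    rw [le_div_iff₀ (by positivity)] at this
    linarith
  refine ⟨ρ, ρ ^ 2 * (k / 2), hρ0, by positivity, fun u hu => ?_, fun u hu => ?_⟩
  · refine le_trans ?_ (hmain u (hu.trans_le (min_le_left _ _)))
    rw [hu]
    gcongr
    linarith
  · refine le_trans ?_ (hmain u (hu.trans (min_le_left _ _)))
    have : M * ‖u‖ ≤ M * ρ := by gcongr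
    exact mul_nonneg (by positivity) (by linarith)

theorem bddAbove_range_energy {a lam p : ℝ} (hp2 : 2 < p) (hp6 : p ≤ 6) (γ : C(unitInterval, H1)) :
    BddAbove (Set.range fun t => energy a lam p (γ t)) :=
  (isCompact_range ((contDiff_energy hp2 hp6).continuous.comp γ.continuous)).bddAbove

/-- The endpoint has negative energy, hence lies outside the ball of radius `ρ`, and the norm takes
the value `ρ` along the path. -/
theorem exists_le_energy_of_path {a lam p ρ α : ℝ} (hρ : 0 < ρ)
    (h1 : ∀ u : H1, ‖u‖ = ρ → α ≤ energy a lam p u)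
    (h2 : ∀ u : H1, ‖u‖ ≤ ρ → 0 ≤ energy a lam p u)
    {γ : C(unitInterval, H1)} (hγ : γ ∈ paths a lam p) : ∃ t, α ≤ energy a lam p (γ t) := by
  have hc : Continuous fun t => ‖γ t‖ := γ.continuous.norm
  have h3 : ρ ≤ ‖γ 1‖ := by
    by_contra! h
    exact absurd (h2 _ h.le) (not_le.2 hγ.2)
  obtain ⟨t, ht⟩ := intermediate_value_univ (0 : unitInterval) 1 hc
    ⟨by simp only [hγ.1, norm_zero]; exact hρ.le, h3⟩
  exact ⟨t, h1 _ ht⟩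

theorem mountainPassLevel_pos {a lam p : ℝ} (ha : 0 < a) (hlam : 0 < lam) (hp3 : 3 < p)
    (hp4 : p ≤ 4) (hne : (paths a lam p).Nonempty) : 0 < mountainPassLevel a lam p := by
  obtain ⟨ρ, α, hρ, hα, h1, h2⟩ := exists_energy_pos_sphere ha hlam hp3 hp4
  -- Over an empty class of paths the real infimum would be `0` by convention, so positivity needs a
  -- path.
  have := hne.to_subtype
  refine hα.trans_le (le_ciInf fun γ => ?_)
  obtain ⟨t, ht⟩ := exists_le_energy_of_path hρ h1 h2 γ.2
  exact ht.trans (le_ciSup (bddAbove_range_energy (by linarith) (by linarith) γ.1) t)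

/-- A smooth bump, whose classical gradient is a weak one by integration by parts. It supplies the
ray on which the energy becomes negative. -/
theorem exists_posPowTerm_six_pos : ∃ w : H1, 0 < posPowTerm 6 w := by
  let η : ContDiffBump (0 : R3) := ⟨1, 2, by norm_num, by norm_num⟩
  have hη : ContDiff ℝ ∞ η := η.contDiff
  have hηc := η.hasCompactSupport
  have hη1 : ContDiff ℝ 1 η := η.contDiff
  let g : R3 → R3 := fun x => (InnerProductSpace.toDual ℝ R3).symm (fderiv ℝ η x)
  have hgi : ∀ x v, inner ℝ (g x) v = fderiv ℝ η x v := fun x v => by simp [g]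
  have hgc : Continuous g :=
    (InnerProductSpace.toDual ℝ R3).symm.continuous.comp (hη1.continuous_fderiv one_ne_zero)
  have hgs : HasCompactSupport g :=
    (hηc.fderiv ℝ).comp_left (g := (InnerProductSpace.toDual ℝ R3).symm) (map_zero _)
  have hηL : MemLp η 2 (volume : Measure R3) := η.continuous.memLp_of_hasCompactSupport hηc
  have hgL : MemLp g 2 (volume : Measure R3) := hgc.memLp_of_hasCompactSupport hgs
  let W : L2Pair := WithLp.toLp 2 (hηL.toLp η, hgL.toLp g)
  have hW : W ∈ sobolevH1 := by
    intro φ hφ hφc v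
    have hφ1 : ContDiff ℝ 1 φ := hφ.of_le (by simp)
    have h1 : ∫ x, W.fst x * fderiv ℝ φ x v = ∫ x, η x * fderiv ℝ φ x v := by
      refine integral_congr_ae ?_
      filter_upwards [hηL.coeFn_toLp] with x hx
      change (hηL.toLp η) x * _ = _
      rw [hx]
    have h2 : ∫ x, inner ℝ (W.snd x) v * φ x = ∫ x, fderiv ℝ η x v * φ x := by
      refine integral_congr_ae ?_
      filter_upwards [hgL.coeFn_toLp] with x hx
      change inner ℝ ((hgL.toLp g) x) v * _ = _
      rw [hx, hgi]
    rw [h1, h2]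
    have hd1 : Continuous fun x => fderiv ℝ η x v :=
      (hη1.continuous_fderiv one_ne_zero).clm_apply continuous_const
    have hd2 : Continuous fun x => fderiv ℝ φ x v :=
      (hφ1.continuous_fderiv one_ne_zero).clm_apply continuous_const
    refine integral_mul_fderiv_eq_neg_fderiv_mul_of_integrable ?_ ?_ ?_
      (fun x _ => hη1.differentiable one_ne_zero x)
      (fun x _ => hφ1.differentiable one_ne_zero x)
    · exact (hd1.mul hφ1.continuous).integrable_of_hasCompactSupport hφc.mul_left
    · exact (η.continuous.mul hd2).integrable_of_hasCompactSupport hηc.mul_right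
    · exact (η.continuous.mul hφ1.continuous).integrable_of_hasCompactSupport hφc.mul_left
  refine ⟨⟨W, hW⟩, ?_⟩
  have h3 : posPowTerm 6 ⟨W, hW⟩ = ∫ x, max (η x) 0 ^ (6 : ℝ) := by
    refine integral_congr_ae ?_
    filter_upwards [hηL.coeFn_toLp] with x hx
    change max ((hηL.toLp η) x) 0 ^ (6 : ℝ) = _
    rw [hx]
  rw [h3]
  have hcont : Continuous fun x => max (η x) 0 ^ (6 : ℝ) :=
    (η.continuous.max continuous_const).rpow_const fun _ => Or.inr (by norm_num)
  refine hcont.integral_pos_of_hasCompactSupport_nonneg_nonzero (x := 0)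
    (hηc.comp_left (g := fun s : ℝ => max s 0 ^ (6 : ℝ)) (by norm_num))
    (fun x => Real.rpow_nonneg (le_max_right _ _) _) ?_
  have h4 : η 0 = 1 := η.one_of_mem_closedBall (by simp [η])
  rw [h4]
  norm_num

theorem nonempty_paths {a lam p : ℝ} (ha : 0 < a) (hlam : 0 < lam) (hp0 : 0 < p) :
    (paths a lam p).Nonempty := by
  obtain ⟨w, hw⟩ := exists_posPowTerm_six_pos
  set A := 1 / 2 * gradTerm w + a / 2 * massTerm w with hA
  set B := 1 / 4 * poissonTerm w with hB
  have hA0 : 0 ≤ A := add_nonneg (mul_nonneg (by norm_num) (gradTerm_nonneg w))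
    (mul_nonneg (by linarith) (massTerm_nonneg w))
  have hB0 : 0 ≤ B := mul_nonneg (by norm_num) (poissonTerm_nonneg w)
  set E := posPowTerm 6 w with hE
  -- With `T ≥ 1` and `T E = E + 6 (A + B)`, one has `T² A + T⁴ B ≤ T⁴ (A + B) < T⁵ E / 6 ≤ T⁶ E /
  -- 6`.
  set T := 1 + 6 * (A + B) / E with hT
  have hT1 : 1 ≤ T := le_add_of_nonneg_right (by positivity)
  have hTE : A + B < T * E / 6 := by
    have : T * E = E + 6 * (A + B) := by rw [hT]; field_simp
    linarith
  refine ⟨⟨fun t => ((t : ℝ) * T) • w, by fun_prop⟩, by simp, ?_⟩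
  simp only [ContinuousMap.coe_mk, Set.Icc.coe_one, one_mul]
  rw [energy_smul a lam p (by linarith)]
  have h6 : T ^ (6 : ℝ) = T ^ 6 := by exact_mod_cast Real.rpow_natCast T 6
  rw [h6]
  have h1 : 0 ≤ lam / p * (T ^ p * posPowTerm p w) :=
    mul_nonneg (by positivity) (mul_nonneg (by positivity) (posPowTerm_nonneg _ _))
  have h2 : T ^ 2 ≤ T ^ 4 := pow_le_pow_right₀ hT1 (by norm_num)
  have h3 : T ^ 5 ≤ T ^ 6 := pow_le_pow_right₀ hT1 (by norm_num)
  have h4 : T ^ 4 * (A + B) < T ^ 4 * (T * E / 6) := by gcongr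
  have h5 : T ^ 5 * E ≤ T ^ 6 * E := by gcongr
  have h7 : T ^ 2 * A ≤ T ^ 4 * A := by gcongr
  have h8 : T ^ 4 * (T * E / 6) = T ^ 5 * E / 6 := by ring
  have h9 : 1 / 2 * (T ^ 2 * gradTerm w) + a / 2 * (T ^ 2 * massTerm w) = T ^ 2 * A := by
    rw [hA]; ring
  have h10 : 1 / 4 * (T ^ 4 * poissonTerm w) = T ^ 4 * B := by rw [hB]; ring
  rw [h9, h10]
  linarith

/-! ### Dilations of `L²`. -/

theorem integral_comp_exp_smul {F : Type*} [NormedAddCommGroup F] [NormedSpace ℝ F] (f : R3 → F)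
    (θ : ℝ) : ∫ x, f (Real.exp θ • x) = Real.exp (-3 * θ) • ∫ x, f x := by
  rw [Measure.integral_comp_smul_of_nonneg volume f _ (hR := (Real.exp_pos θ).le)]
  congr 1
  rw [← Real.exp_nat_mul, ← Real.exp_neg]
  simp

theorem memLp_comp_exp_smul {E : Type*} [NormedAddCommGroup E] {f : R3 → E}
    (hf : MemLp f 2 volume) (θ : ℝ) :
    MemLp (fun x => f (Real.exp θ • x)) 2 volume := by
  have h : MemLp f 2 (Measure.map (fun x : R3 => Real.exp θ • x) volume) := by
    rw [Measure.map_addHaar_smul volume (Real.exp_pos θ).ne']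
    exact hf.smul_measure ENNReal.ofReal_ne_top
  exact h.comp_of_map (measurable_const_smul _).aemeasurable

theorem ae_eq_comp_exp_smul {β : Type*} {f g : R3 → β} (h : f =ᵐ[volume] g) (θ : ℝ) :
    (fun x => f (Real.exp θ • x)) =ᵐ[volume] fun x => g (Real.exp θ • x) :=
  (Measure.quasiMeasurePreserving_smul volume (Real.exp_pos θ).ne').ae_eq_comp h

section Lp

variable {E : Type*} [NormedAddCommGroup E]

/-- The dilation `f ↦ f(e^θ ·)` of `L²(ℝ³)`. -/
noncomputable def dilationLp (θ : ℝ) (f : Lp E 2 (volume : Measure R3)) :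
    Lp E 2 (volume : Measure R3) :=
  (memLp_comp_exp_smul (Lp.memLp f) θ).toLp _

theorem coeFn_dilationLp (θ : ℝ) (f : Lp E 2 (volume : Measure R3)) :
    dilationLp θ f =ᵐ[volume] fun x => f (Real.exp θ • x) :=
  MemLp.coeFn_toLp _

theorem dilationLp_add (θ : ℝ) (f g : Lp E 2 (volume : Measure R3)) :
    dilationLp θ (f + g) = dilationLp θ f + dilationLp θ g := by
  refine Lp.ext ?_
  filter_upwards [coeFn_dilationLp θ (f + g), coeFn_dilationLp θ f, coeFn_dilationLp θ g,
    Lp.coeFn_add (dilationLp θ f) (dilationLp θ g),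
    ae_eq_comp_exp_smul (Lp.coeFn_add f g) θ] with x h1 h2 h3 h4 h5
  rw [h1, h4, Pi.add_apply, h2, h3, h5, Pi.add_apply]

theorem dilationLp_neg_dilationLp (θ : ℝ) (f : Lp E 2 (volume : Measure R3)) :
    dilationLp θ (dilationLp (-θ) f) = f := by
  refine Lp.ext ?_
  filter_upwards [coeFn_dilationLp θ (dilationLp (-θ) f),
    ae_eq_comp_exp_smul (coeFn_dilationLp (-θ) f) θ] with x h1 h2
  rw [h1, h2, smul_smul, ← Real.exp_add, neg_add_cancel, Real.exp_zero, one_smul]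

variable [InnerProductSpace ℝ E]

theorem dilationLp_smul (θ c : ℝ) (f : Lp E 2 (volume : Measure R3)) :
    dilationLp θ (c • f) = c • dilationLp θ f := by
  refine Lp.ext ?_
  filter_upwards [coeFn_dilationLp θ (c • f), coeFn_dilationLp θ f,
    Lp.coeFn_smul c (dilationLp θ f),
    ae_eq_comp_exp_smul (Lp.coeFn_smul c f) θ] with x h1 h2 h4 h5
  rw [h1, h4, Pi.smul_apply, h2, h5, Pi.smul_apply]

theorem dilationLp_sub (θ : ℝ) (f g : Lp E 2 (volume : Measure R3)) :
    dilationLp θ (f - g) = dilationLp θ f - dilationLp θ g := by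
  rw [sub_eq_add_neg, ← neg_one_smul ℝ g, dilationLp_add, dilationLp_smul, neg_one_smul,
    ← sub_eq_add_neg]

theorem norm_dilationLp_sq (θ : ℝ) (f : Lp E 2 (volume : Measure R3)) :
    ‖dilationLp θ f‖ ^ 2 = Real.exp (-3 * θ) * ‖f‖ ^ 2 := by
  rw [← integral_norm_sq_Lp, ← integral_norm_sq_Lp, ← smul_eq_mul,
    ← integral_comp_exp_smul (fun x => ‖f x‖ ^ 2)]
  refine integral_congr_ae ?_
  filter_upwards [coeFn_dilationLp θ f] with x hx
  rw [hx]

theorem norm_dilationLp (θ : ℝ) (f : Lp E 2 (volume : Measure R3)) :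
    ‖dilationLp θ f‖ = Real.exp (-3 / 2 * θ) * ‖f‖ := by
  rw [← Real.sqrt_sq (norm_nonneg (dilationLp θ f)), norm_dilationLp_sq,
    Real.sqrt_eq_iff_mul_self_eq (by positivity) (by positivity)]
  rw [mul_mul_mul_comm, ← Real.exp_add, sq]
  ring_nf

theorem tendsto_dilationLp_of_hasCompactSupport {g : R3 → E} (hg : Continuous g)
    (hgc : HasCompactSupport g) (hgL : MemLp g 2 volume) (θ₀ : ℝ) :
    Tendsto (fun θ => ‖dilationLp θ (hgL.toLp g) - dilationLp θ₀ (hgL.toLp g)‖) (𝓝 θ₀) (𝓝 0) := by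
  obtain ⟨B, hB⟩ := hg.bounded_above_of_compact_support hgc
  obtain ⟨R, hR⟩ := hgc.isCompact.isBounded.subset_closedBall (0 : R3)
  have hzero : ∀ x : R3, R < ‖x‖ → g x = 0 := fun x hx => by
    refine image_eq_zero_of_notMem_tsupport fun hmem => ?_
    have := hR hmem
    rw [mem_closedBall_zero_iff] at this
    linarith
  have hsq : ∀ θ, ‖dilationLp θ (hgL.toLp g) - dilationLp θ₀ (hgL.toLp g)‖ ^ 2
      = ∫ x, ‖g (Real.exp θ • x) - g (Real.exp θ₀ • x)‖ ^ 2 := by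
    intro θ
    rw [← integral_norm_sq_Lp]
    refine integral_congr_ae ?_
    filter_upwards [Lp.coeFn_sub (dilationLp θ (hgL.toLp g)) (dilationLp θ₀ (hgL.toLp g)),
      coeFn_dilationLp θ (hgL.toLp g), coeFn_dilationLp θ₀ (hgL.toLp g),
      ae_eq_comp_exp_smul hgL.coeFn_toLp θ, ae_eq_comp_exp_smul hgL.coeFn_toLp θ₀]
      with x h1 h2 h3 h4 h5
    rw [h1, Pi.sub_apply, h2, h3, h4, h5]
  -- For `|θ - θ₀| < 1` both dilates vanish outside the ball of radius `r`, which gives an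
  -- integrable dominating function.
  set r := R * Real.exp (1 - θ₀) with hr
  have hlim : Tendsto (fun θ => ∫ x, ‖g (Real.exp θ • x) - g (Real.exp θ₀ • x)‖ ^ 2) (𝓝 θ₀)
      (𝓝 (∫ _ : R3, (0 : ℝ))) := by
    refine tendsto_integral_filter_of_dominated_convergence
      ((Metric.closedBall (0 : R3) r).indicator fun _ => (2 * B) ^ 2) ?_ ?_ ?_ ?_
    · refine Eventually.of_forall fun θ => Continuous.aestronglyMeasurable ?_
      fun_prop
    · filter_upwards [Metric.ball_mem_nhds θ₀ one_pos] with θ hθ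
      refine ae_of_all _ fun x => ?_
      rw [Real.norm_of_nonneg (by positivity)]
      by_cases hx : x ∈ Metric.closedBall (0 : R3) r
      · rw [Set.indicator_of_mem hx]
        gcongr
        exact (norm_sub_le _ _).trans (by linarith [hB (Real.exp θ • x), hB (Real.exp θ₀ • x)])
      · rw [Set.indicator_of_notMem hx]
        have hx' : r < ‖x‖ := by simpa using hx
        have hbig : ∀ τ, θ₀ - 1 < τ → g (Real.exp τ • x) = 0 := by
          intro τ hτ
          apply hzero
          rw [norm_smul, Real.norm_of_nonneg (Real.exp_pos _).le]
          have h1 : R = r * Real.exp (θ₀ - 1) := by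
            rw [hr, mul_assoc, ← Real.exp_add]; simp
          rw [h1, mul_comm]
          calc Real.exp (θ₀ - 1) * r < Real.exp (θ₀ - 1) * ‖x‖ := by gcongr
            _ ≤ Real.exp τ * ‖x‖ := by gcongr
        rw [Real.ball_eq_Ioo] at hθ
        rw [hbig θ hθ.1, hbig θ₀ (by linarith)]
        simp
    · rw [integrable_indicator_iff Metric.isClosed_closedBall.measurableSet]
      exact integrableOn_const (s := Metric.closedBall (0 : R3) r)
        (measure_closedBall_lt_top (μ := volume)).ne enorm_ne_top
    · refine ae_of_all _ fun x => ?_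
      have : Continuous fun θ => ‖g (Real.exp θ • x) - g (Real.exp θ₀ • x)‖ ^ 2 := by fun_prop
      simpa using this.tendsto θ₀
  simp only [integral_zero, ← hsq] at hlim
  have := hlim.sqrt
  simpa only [Real.sqrt_sq (norm_nonneg _), Real.sqrt_zero] using this

/-- Density of continuous compactly supported functions, combined with a bound on dilation norms
that is uniform for `θ` near `θ₀`. -/
theorem continuous_dilationLp_left (f : Lp E 2 (volume : Measure R3)) :
    Continuous fun θ => dilationLp θ f := by
  refine continuous_iff_continuousAt.2 fun θ₀ => Metric.tendsto_nhds.2 fun ε hε => ?_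
  set C := Real.exp (-3 / 2 * θ₀) + 1 with hC
  have hC0 : 0 < C := by positivity
  have hCev : ∀ᶠ θ in 𝓝 θ₀, Real.exp (-3 / 2 * θ) < C := by
    have : Continuous fun θ : ℝ => Real.exp (-3 / 2 * θ) := by fun_prop
    exact (this.tendsto θ₀) (gt_mem_nhds (lt_add_one _))
  set δ := ε / (4 * C) with hδ
  have hδ0 : 0 < δ := by positivity
  obtain ⟨g, hgc, hfg, hg, hgL⟩ := (Lp.memLp f).exists_hasCompactSupport_eLpNorm_sub_le
    (by simp) (ε := ENNReal.ofReal δ) (by simpa using hδ0)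
  have hfg' : ‖f - hgL.toLp g‖ ≤ δ := by
    rw [Lp.norm_def]
    refine ENNReal.toReal_le_of_le_ofReal hδ0.le (le_of_eq_of_le (eLpNorm_congr_ae ?_) hfg)
    filter_upwards [Lp.coeFn_sub f (hgL.toLp g), hgL.coeFn_toLp] with x h1 h2
    rw [h1, Pi.sub_apply, h2, Pi.sub_apply]
  have hbd : ∀ θ, Real.exp (-3 / 2 * θ) < C → ‖dilationLp θ f - dilationLp θ (hgL.toLp g)‖
      ≤ ε / 4 := by
    intro θ hθ
    rw [← dilationLp_sub, norm_dilationLp]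
    calc Real.exp (-3 / 2 * θ) * ‖f - hgL.toLp g‖ ≤ C * δ := by gcongr
      _ = ε / 4 := by rw [hδ]; field_simp
  filter_upwards [hCev, (tendsto_dilationLp_of_hasCompactSupport hg hgc hgL θ₀)
    (gt_mem_nhds (half_pos hε))] with θ h1 h2
  have h3 := hbd θ h1
  have h4 := hbd θ₀ (lt_add_one _)
  rw [dist_eq_norm]
  have h5 : dilationLp θ f - dilationLp θ₀ f = (dilationLp θ f - dilationLp θ (hgL.toLp g))
      + (dilationLp θ (hgL.toLp g) - dilationLp θ₀ (hgL.toLp g))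
      - (dilationLp θ₀ f - dilationLp θ₀ (hgL.toLp g)) := by abel
  rw [h5]
  refine (norm_sub_le _ _).trans_lt ?_
  have h6 := norm_add_le (dilationLp θ f - dilationLp θ (hgL.toLp g))
    (dilationLp θ (hgL.toLp g) - dilationLp θ₀ (hgL.toLp g))
  have h7 : ‖dilationLp θ (hgL.toLp g) - dilationLp θ₀ (hgL.toLp g)‖ < ε / 2 := h2
  linarith

/-- Joint continuity follows from strong continuity in `θ` and the explicit operator norm. -/
theorem continuous_dilationLp :
    Continuous fun z : ℝ × Lp E 2 (volume : Measure R3) => dilationLp z.1 z.2 := by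
  refine continuous_iff_continuousAt.2 fun z₀ => tendsto_iff_norm_sub_tendsto_zero.2 ?_
  have h1 : Continuous fun z : ℝ × Lp E 2 (volume : Measure R3) =>
      Real.exp (-3 / 2 * z.1) * ‖z.2 - z₀.2‖ + ‖dilationLp z.1 z₀.2 - dilationLp z₀.1 z₀.2‖ := by
    have := (continuous_dilationLp_left z₀.2).comp (continuous_fst (X := ℝ)
      (Y := Lp E 2 (volume : Measure R3)))
    fun_prop
  have h2 := h1.tendsto z₀
  simp only [sub_self, norm_zero, mul_zero, add_zero] at h2
  refine squeeze_zero (fun _ => norm_nonneg _) (fun z => ?_) h2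
  rw [← norm_dilationLp, dilationLp_sub]
  exact norm_sub_le_norm_sub_add_norm_sub _ _ _

end Lp

/-! ### Dilations of `H¹` and the scaling of each term. -/

/-- The dilation `u ↦ e^{2θ} u(e^θ ·)` of `H¹(ℝ³)`. -/
noncomputable def dilation (θ : ℝ) : H1 →ₗ[ℝ] H1 where
  toFun u := ⟨WithLp.toLp 2 (Real.exp (2 * θ) • dilationLp θ u.1.fst,
      Real.exp (3 * θ) • dilationLp θ u.1.snd), by
    intro φ hφ hφc v
    -- Rescaling the test function reduces the identity to that of `u`: on both sides the factor
    -- `e^{3θ}` cancels the Jacobian `e^{-3θ}`.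
    let ψ : R3 → ℝ := fun y => φ (Real.exp (-θ) • y)
    have hψ : ContDiff ℝ ∞ ψ := hφ.comp (contDiff_const_smul _)
    have hψc : HasCompactSupport ψ := hφc.comp_smul (Real.exp_pos _).ne'
    have hφψ : ∀ x, φ x = ψ (Real.exp θ • x) := fun x => by
      simp only [ψ]
      rw [smul_smul, ← Real.exp_add, neg_add_cancel, Real.exp_zero, one_smul]
    have hd : ∀ x, fderiv ℝ φ x v = Real.exp θ * fderiv ℝ ψ (Real.exp θ • x) v := fun x => by
      have : φ = fun x => ψ (Real.exp θ • x) := funext hφψ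
      conv_lhs => rw [this, fderiv_comp_smul]
      rfl
    have h := u.2 ψ hψ hψc v
    have h1 : ∫ x, (Real.exp (2 * θ) • dilationLp θ u.1.fst : Lp ℝ 2 (volume : Measure R3)) x
        * fderiv ℝ φ x v = ∫ y, u.1.fst y * fderiv ℝ ψ y v := by
      have h2 : ∫ x, (Real.exp (2 * θ) • dilationLp θ u.1.fst : Lp ℝ 2 (volume : Measure R3)) x
          * fderiv ℝ φ x v = ∫ x, Real.exp (3 * θ) * (u.1.fst (Real.exp θ • x)
            * fderiv ℝ ψ (Real.exp θ • x) v) := by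
        refine integral_congr_ae ?_
        filter_upwards [Lp.coeFn_smul (Real.exp (2 * θ)) (dilationLp θ u.1.fst),
          coeFn_dilationLp θ u.1.fst] with x hx1 hx2
        rw [hx1, Pi.smul_apply, hx2, hd, show 3 * θ = 2 * θ + θ by ring, Real.exp_add, smul_eq_mul]
        ring
      rw [h2, integral_const_mul,
        integral_comp_exp_smul (fun y => u.1.fst y * fderiv ℝ ψ y v), smul_eq_mul, ← mul_assoc,
        ← Real.exp_add]
      simp
    have h3 : ∫ x, inner ℝ ((Real.exp (3 * θ) • dilationLp θ u.1.snd :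
        Lp R3 2 (volume : Measure R3)) x) v * φ x = ∫ y, inner ℝ (u.1.snd y) v * ψ y := by
      have h2 : ∫ x, inner ℝ ((Real.exp (3 * θ) • dilationLp θ u.1.snd :
          Lp R3 2 (volume : Measure R3)) x) v * φ x
          = ∫ x, Real.exp (3 * θ) * (inner ℝ (u.1.snd (Real.exp θ • x)) v
            * ψ (Real.exp θ • x)) := by
        refine integral_congr_ae ?_
        filter_upwards [Lp.coeFn_smul (Real.exp (3 * θ)) (dilationLp θ u.1.snd),
          coeFn_dilationLp θ u.1.snd] with x hx1 hx2
        rw [hx1, Pi.smul_apply, hx2, hφψ, real_inner_smul_left, mul_assoc]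
      rw [h2, integral_const_mul,
        integral_comp_exp_smul (fun y => inner ℝ (u.1.snd y) v * ψ y), smul_eq_mul, ← mul_assoc,
        ← Real.exp_add]
      simp
    exact h1.trans (h.trans (congrArg Neg.neg h3.symm))⟩
  map_add' u v := by
    refine Subtype.ext (WithLp.ofLp_injective 2 (Prod.ext ?_ ?_))
    · change Real.exp (2 * θ) • dilationLp θ (u.1.fst + v.1.fst) = _ • _ + _ • _
      rw [dilationLp_add, smul_add]
    · change Real.exp (3 * θ) • dilationLp θ (u.1.snd + v.1.snd) = _ • _ + _ • _
      rw [dilationLp_add, smul_add]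
  map_smul' c u := by
    refine Subtype.ext (WithLp.ofLp_injective 2 (Prod.ext ?_ ?_))
    · change Real.exp (2 * θ) • dilationLp θ (c • u.1.fst) = c • _ • _
      rw [dilationLp_smul, smul_comm]
    · change Real.exp (3 * θ) • dilationLp θ (c • u.1.snd) = c • _ • _
      rw [dilationLp_smul, smul_comm]

theorem toL2_dilation (θ : ℝ) (u : H1) :
    H1.toL2 (dilation θ u) = Real.exp (2 * θ) • dilationLp θ (H1.toL2 u) := rfl

theorem gradL2_dilation (θ : ℝ) (u : H1) :
    H1.gradL2 (dilation θ u) = Real.exp (3 * θ) • dilationLp θ (H1.gradL2 u) := rfl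

theorem H1.ext_toL2_gradL2 {u v : H1} (h1 : H1.toL2 u = H1.toL2 v)
    (h2 : H1.gradL2 u = H1.gradL2 v) : u = v :=
  Subtype.ext (WithLp.ofLp_injective 2 (Prod.ext h1 h2))

theorem dilation_neg_dilation (θ : ℝ) (u : H1) : dilation θ (dilation (-θ) u) = u := by
  refine H1.ext_toL2_gradL2 ?_ ?_
  · rw [toL2_dilation, toL2_dilation, dilationLp_smul, dilationLp_neg_dilationLp, smul_smul,
      ← Real.exp_add]
    simp
  · rw [gradL2_dilation, gradL2_dilation, dilationLp_smul, dilationLp_neg_dilationLp, smul_smul,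
      ← Real.exp_add]
    simp

theorem dilation_zero (u : H1) : dilation 0 u = u := by
  refine H1.ext_toL2_gradL2 (Lp.ext ?_) (Lp.ext ?_)
  · rw [toL2_dilation, mul_zero, Real.exp_zero, one_smul]
    filter_upwards [coeFn_dilationLp 0 (H1.toL2 u)] with x hx
    rw [hx, Real.exp_zero, one_smul]
  · rw [gradL2_dilation, mul_zero, Real.exp_zero, one_smul]
    filter_upwards [coeFn_dilationLp 0 (H1.gradL2 u)] with x hx
    rw [hx, Real.exp_zero, one_smul]

theorem val_dilation (θ : ℝ) (u : H1) :
    (dilation θ u).val =ᵐ[volume] fun x => Real.exp (2 * θ) * u.val (Real.exp θ • x) := by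
  filter_upwards [Lp.coeFn_smul (Real.exp (2 * θ)) (dilationLp θ (H1.toL2 u)),
    coeFn_dilationLp θ (H1.toL2 u)] with x h1 h2
  refine Eq.trans h1 ?_
  rw [Pi.smul_apply, h2]
  rfl

theorem gradTerm_dilation (θ : ℝ) (u : H1) :
    gradTerm (dilation θ u) = Real.exp (3 * θ) * gradTerm u := by
  rw [gradTerm_eq, gradTerm_eq, gradL2_dilation, norm_smul, mul_pow, norm_dilationLp_sq,
    ← mul_assoc, Real.norm_eq_abs, sq_abs, ← Real.exp_nat_mul, ← Real.exp_add]
  congr 2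
  push_cast
  ring

theorem massTerm_dilation (θ : ℝ) (u : H1) :
    massTerm (dilation θ u) = Real.exp θ * massTerm u := by
  rw [massTerm_eq, massTerm_eq, toL2_dilation, norm_smul, mul_pow, norm_dilationLp_sq,
    ← mul_assoc, Real.norm_eq_abs, sq_abs, ← Real.exp_nat_mul, ← Real.exp_add]
  congr 2
  push_cast
  ring

theorem posPowTerm_dilation (q θ : ℝ) (u : H1) :
    posPowTerm q (dilation θ u) = Real.exp ((2 * q - 3) * θ) * posPowTerm q u := by
  have h1 : posPowTerm q (dilation θ u)
      = ∫ x, Real.exp (2 * θ * q) * max (u.val (Real.exp θ • x)) 0 ^ q := by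
    refine integral_congr_ae ?_
    filter_upwards [val_dilation θ u] with x hx
    rw [hx, Real.exp_mul (2 * θ) q, ← Real.mul_rpow (Real.exp_pos _).le (le_max_right _ _),
      mul_max_of_nonneg _ _ (Real.exp_pos _).le, mul_zero]
  rw [h1, integral_const_mul, integral_comp_exp_smul (fun x => max (u.val x) 0 ^ q), smul_eq_mul,
    ← mul_assoc, ← Real.exp_add, posPowTerm]
  congr 2
  ring

theorem poissonPotential_dilation (θ : ℝ) (u : H1) (x : R3) :
    poissonPotential (dilation θ u) x = Real.exp (2 * θ) * poissonPotential u (Real.exp θ • x) := by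
  have h1 : ∫ y, (dilation θ u).val y ^ 2 / ‖x - y‖
      = ∫ y, Real.exp (5 * θ) * (u.val (Real.exp θ • y) ^ 2
        / ‖Real.exp θ • x - Real.exp θ • y‖) := by
    refine integral_congr_ae ?_
    filter_upwards [val_dilation θ u] with y hy
    rw [hy, ← smul_sub, norm_smul, Real.norm_of_nonneg (Real.exp_pos _).le,
      show 5 * θ = 2 * θ + 2 * θ + θ by ring, Real.exp_add, Real.exp_add]
    have := (Real.exp_pos θ).ne'
    -- On the diagonal both quotients are `0` by the convention for division by zero.
    rcases eq_or_ne ‖x - y‖ 0 with h0 | h0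
    · rw [h0]; simp
    · field_simp
  rw [poissonPotential, poissonPotential, h1, integral_const_mul,
    integral_comp_exp_smul (fun y => u.val y ^ 2 / ‖Real.exp θ • x - y‖), smul_eq_mul,
    ← mul_assoc (Real.exp _), ← Real.exp_add, mul_left_comm]
  congr 2
  ring

theorem poissonTerm_dilation (θ : ℝ) (u : H1) :
    poissonTerm (dilation θ u) = Real.exp (3 * θ) * poissonTerm u := by
  have h1 : poissonTerm (dilation θ u) = ∫ x, Real.exp (6 * θ)
      * (poissonPotential u (Real.exp θ • x) * u.val (Real.exp θ • x) ^ 2) := by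
    refine integral_congr_ae ?_
    filter_upwards [val_dilation θ u] with x hx
    rw [hx, poissonPotential_dilation, show 6 * θ = 2 * θ + 2 * θ + 2 * θ by ring, Real.exp_add,
      Real.exp_add]
    ring
  rw [h1, integral_const_mul,
    integral_comp_exp_smul (fun x => poissonPotential u x * u.val x ^ 2), smul_eq_mul,
    ← mul_assoc, ← Real.exp_add, poissonTerm]
  congr 2
  ring

/-- The squared norm scales by `e^{3θ}` and `e^θ` on its two parts, both at most `e^{4|θ|}`. -/
theorem norm_dilation_le (θ : ℝ) (u : H1) : ‖dilation θ u‖ ≤ Real.exp (2 * |θ|) * ‖u‖ := by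
  refine abs_le_of_sq_le_sq' ?_ (by positivity) |>.2
  rw [mul_pow, norm_sq_eq_gradTerm_add_massTerm, norm_sq_eq_gradTerm_add_massTerm,
    gradTerm_dilation, massTerm_dilation, ← Real.exp_nat_mul, mul_add]
  have h1 : 3 * θ ≤ (2 : ℕ) * (2 * |θ|) := by push_cast; linarith [le_abs_self θ, abs_nonneg θ]
  have h2 : θ ≤ (2 : ℕ) * (2 * |θ|) := by push_cast; linarith [le_abs_self θ, abs_nonneg θ]
  have := gradTerm_nonneg u
  have := massTerm_nonneg u
  gcongr

theorem continuous_dilation : Continuous fun z : ℝ × H1 => dilation z.1 z.2 := by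
  refine Continuous.subtype_mk ?_ _
  refine (WithLp.prod_continuous_toLp 2 _ _).comp (Continuous.prodMk ?_ ?_)
  · have h := (continuous_dilationLp (E := ℝ)).comp
      (continuous_fst.prodMk (H1.toL2.continuous.comp continuous_snd) :
        Continuous fun z : ℝ × H1 => (z.1, H1.toL2 z.2))
    have h2 : Continuous fun z : ℝ × H1 => Real.exp (2 * z.1) := by fun_prop
    exact h2.smul h
  · have h := (continuous_dilationLp (E := R3)).comp
      (continuous_fst.prodMk (H1.gradL2.continuous.comp continuous_snd) :
        Continuous fun z : ℝ × H1 => (z.1, H1.gradL2 z.2))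
    have h2 : Continuous fun z : ℝ × H1 => Real.exp (3 * z.1) := by fun_prop
    exact h2.smul h

/-! ### The energy on `ℝ × H¹`. -/

theorem energy_dilation (a lam p θ : ℝ) (u : H1) :
    energy a lam p (dilation θ u) = 1 / 2 * (Real.exp (3 * θ) * gradTerm u)
      + a / 2 * (Real.exp θ * massTerm u) + 1 / 4 * (Real.exp (3 * θ) * poissonTerm u)
      - lam / p * (Real.exp ((2 * p - 3) * θ) * posPowTerm p u)
      - 1 / 6 * (Real.exp (9 * θ) * posPowTerm 6 u) := by
  rw [energy, gradTerm_dilation, massTerm_dilation, poissonTerm_dilation, posPowTerm_dilation,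
    posPowTerm_dilation, show (2 * 6 - 3 : ℝ) = 9 by norm_num]

/-- The energy of the dilated function, on the Hilbert space `ℝ × H¹`. -/
noncomputable def dilatedEnergy (a lam p : ℝ) (z : WithLp 2 (ℝ × H1)) : ℝ :=
  energy a lam p (dilation z.fst z.snd)

/-- Smoothness is read off the explicit formula, in which `θ` enters only through exponentials. The
chain rule is not used here: the dilation map has only been shown jointly continuous, not
differentiable in `θ`. -/
theorem contDiff_dilatedEnergy {a lam p : ℝ} (hp2 : 2 < p) (hp6 : p ≤ 6) :
    ContDiff ℝ 1 (dilatedEnergy a lam p) := by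
  have hf : ContDiff ℝ 1 fun z : WithLp 2 (ℝ × H1) => z.fst := (WithLp.fstL 2 ℝ ℝ H1).contDiff
  have hs : ContDiff ℝ 1 fun z : WithLp 2 (ℝ × H1) => z.snd := (WithLp.sndL 2 ℝ ℝ H1).contDiff
  have h1 := contDiff_gradTerm.comp hs
  have h2 := contDiff_massTerm.comp hs
  have h3 := contDiff_poissonTerm.comp hs
  have h4 := (contDiff_posPowTerm hp2 hp6).comp hs
  have h5 := (contDiff_posPowTerm (q := 6) (by norm_num) le_rfl).comp hs
  have he : ∀ k : ℝ, ContDiff ℝ 1 fun z : WithLp 2 (ℝ × H1) => Real.exp (k * z.fst) := fun k =>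
    (contDiff_const.mul hf).exp
  unfold dilatedEnergy
  simp only [energy_dilation]
  exact ((((contDiff_const.mul ((he 3).mul h1)).add (contDiff_const.mul (hf.exp.mul h2))).add
    (contDiff_const.mul ((he 3).mul h3))).sub (contDiff_const.mul ((he (2 * p - 3)).mul h4))).sub
    (contDiff_const.mul ((he 9).mul h5))

/-- Differentiating in `θ` multiplies the terms by the exponents `3, 1, 3, 2p - 3, 9`, which turns
the coefficients of `I_a` into those of `G_a`. -/
theorem fderiv_dilatedEnergy_fst {a lam p : ℝ} (hp2 : 2 < p) (hp6 : p ≤ 6)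
    (z : WithLp 2 (ℝ × H1)) : fderiv ℝ (dilatedEnergy a lam p) z (WithLp.toLp 2 (1, 0))
      = nehariPohozaev a lam p (dilation z.fst z.snd) := by
  have hd : HasFDerivAt (dilatedEnergy a lam p) (fderiv ℝ (dilatedEnergy a lam p) z)
      (z + (0 : ℝ) • WithLp.toLp 2 (1, 0)) := by
    rw [zero_smul, add_zero]
    exact ((contDiff_dilatedEnergy hp2 hp6).differentiable one_ne_zero z).hasFDerivAt
  have h1 := hd.comp_hasDerivAt (0 : ℝ)
    (((hasDerivAt_id (0 : ℝ)).smul_const (WithLp.toLp 2 ((1 : ℝ), (0 : H1)))).const_add z)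
  rw [one_smul] at h1
  have he : ∀ k : ℝ, HasDerivAt (fun s : ℝ => Real.exp (k * (z.fst + s)))
      (k * Real.exp (k * z.fst)) 0 := fun k => by
    have := (((hasDerivAt_id (0 : ℝ)).const_add z.fst).const_mul k).exp
    simpa [mul_comm] using this
  have he1 := he 1
  simp only [one_mul] at he1
  have h2 := (((((((he 3).mul_const (gradTerm z.snd)).const_mul (1 / 2)).add
      ((he1.mul_const (massTerm z.snd)).const_mul (a / 2))).add
      (((he 3).mul_const (poissonTerm z.snd)).const_mul (1 / 4))).sub
      (((he (2 * p - 3)).mul_const (posPowTerm p z.snd)).const_mul (lam / p))).sub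
      (((he 9).mul_const (posPowTerm 6 z.snd)).const_mul (1 / 6)))
  have h3 := h1.unique (h2.congr_of_eventuallyEq (Eventually.of_forall fun s => by
    have hz1 : (z + s • WithLp.toLp 2 ((1 : ℝ), (0 : H1))).fst = z.fst + s := by simp
    have hz2 : (z + s • WithLp.toLp 2 ((1 : ℝ), (0 : H1))).snd = z.snd := by simp
    simp only [Function.comp_apply, id_eq]
    rw [dilatedEnergy, energy_dilation, hz1, hz2]
    rfl))
  rw [h3, nehariPohozaev, gradTerm_dilation, massTerm_dilation, poissonTerm_dilation,
    posPowTerm_dilation, posPowTerm_dilation, show (2 * 6 - 3 : ℝ) = 9 by norm_num]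
  ring

theorem fderiv_dilatedEnergy_snd {a lam p : ℝ} (hp2 : 2 < p) (hp6 : p ≤ 6)
    (z : WithLp 2 (ℝ × H1)) (w : H1) :
    fderiv ℝ (dilatedEnergy a lam p) z (WithLp.toLp 2 (0, w))
      = fderiv ℝ (energy a lam p) (dilation z.fst z.snd) (dilation z.fst w) := by
  have hd : HasFDerivAt (dilatedEnergy a lam p) (fderiv ℝ (dilatedEnergy a lam p) z)
      (z + (0 : ℝ) • WithLp.toLp 2 (0, w)) := by
    rw [zero_smul, add_zero]
    exact ((contDiff_dilatedEnergy hp2 hp6).differentiable one_ne_zero z).hasFDerivAt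
  have h1 := hd.comp_hasDerivAt (0 : ℝ)
    (((hasDerivAt_id (0 : ℝ)).smul_const (WithLp.toLp 2 ((0 : ℝ), w))).const_add z)
  have hd2 : HasFDerivAt (energy a lam p) (fderiv ℝ (energy a lam p) (dilation z.fst z.snd))
      (dilation z.fst z.snd + (0 : ℝ) • dilation z.fst w) := by
    rw [zero_smul, add_zero]
    exact ((contDiff_energy hp2 hp6).differentiable one_ne_zero _).hasFDerivAt
  have h2 := hd2.comp_hasDerivAt (0 : ℝ)
    (((hasDerivAt_id (0 : ℝ)).smul_const (dilation z.fst w)).const_add (dilation z.fst z.snd))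
  rw [one_smul] at h1 h2
  refine h1.unique (h2.congr_of_eventuallyEq (Eventually.of_forall fun s => ?_))
  have hz1 : (z + s • WithLp.toLp 2 ((0 : ℝ), w)).fst = z.fst := by simp
  have hz2 : (z + s • WithLp.toLp 2 ((0 : ℝ), w)).snd = z.snd + s • w := by simp
  simp only [Function.comp_apply, id_eq]
  rw [dilatedEnergy, hz1, hz2, map_add, map_smul]

/-! ### Construction of the sequence. -/

theorem energy_zero {a lam p : ℝ} (hp0 : p ≠ 0) : energy a lam p 0 = 0 := by
  have := energy_smul a lam p le_rfl (0 : H1)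
  simpa [Real.zero_rpow hp0] using this

theorem exists_mountainPassLevel_le_energy {a lam p : ℝ} (hp2 : 2 < p) (hp6 : p ≤ 6)
    (hbdd : BddBelow (Set.range fun γ : paths a lam p =>
      ⨆ t : unitInterval, energy a lam p (γ.1 t)))
    {γ : C(unitInterval, H1)} (hγ : γ ∈ paths a lam p) :
    ∃ t, mountainPassLevel a lam p ≤ energy a lam p (γ t) := by
  obtain ⟨t, -, ht⟩ := isCompact_univ.exists_isMaxOn Set.univ_nonempty
    (((contDiff_energy (a := a) (lam := lam) hp2 hp6).continuous.comp γ.continuous).continuousOn)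
  refine ⟨t, (ciInf_le hbdd ⟨γ, hγ⟩).trans (ciSup_le fun s => ht (Set.mem_univ s))⟩

/-- Every path starts at energy zero. The bound is what makes the real infimum a genuine lower bound
for each path. -/
theorem bddBelow_range_iSup_energy {a lam p : ℝ} (hp2 : 2 < p) (hp6 : p ≤ 6) :
    BddBelow (Set.range fun γ : paths a lam p =>
      ⨆ t : unitInterval, energy a lam p (γ.1 t)) := by
  refine ⟨0, ?_⟩
  rintro _ ⟨γ, rfl⟩
  have h := le_ciSup (bddAbove_range_energy (a := a) (lam := lam) hp2 hp6 γ.1) 0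
  simp only [γ.2.1, energy_zero (a := a) (lam := lam) (p := p) (by linarith)] at h
  exact h

/-- A nearly optimal path is placed in the slice `θ = 0`. A competitor in `ℝ × H¹` with the same
endpoints projects by `dilation` to a path of `Γ_a`, so the minimax level does not drop. -/
theorem exists_almost_critical {a lam p : ℝ} (hp2 : 2 < p) (hp6 : p ≤ 6)
    (hne : (paths a lam p).Nonempty) (hc : 0 < mountainPassLevel a lam p) {ε : ℝ} (hε : 0 < ε)
    (hε1 : ε ≤ 1) : ∃ u : H1, |energy a lam p u - mountainPassLevel a lam p| ≤ ε ∧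
      ‖fderiv ℝ (energy a lam p) u‖ ≤ ε * Real.exp 2 ∧ |nehariPohozaev a lam p u| ≤ ε := by
  set c := mountainPassLevel a lam p with hcdef
  have hbdd := bddBelow_range_iSup_energy (a := a) (lam := lam) hp2 hp6
  have := hne.to_subtype
  obtain ⟨⟨γ, hγ⟩, hγc⟩ := exists_lt_of_ciInf_lt
    (show (⨅ γ : paths a lam p, ⨆ t : unitInterval, energy a lam p (γ.1 t)) < c + ε ^ 2 from
      lt_add_of_pos_right _ (by positivity))
  let γ₀ : C(unitInterval, WithLp 2 (ℝ × H1)) := ⟨fun t => WithLp.toLp 2 (0, γ t),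
    (WithLp.prod_continuous_toLp 2 _ _).comp (continuous_const.prodMk γ.continuous)⟩
  have hΦγ : ∀ t, dilatedEnergy a lam p (γ₀ t) = energy a lam p (γ t) := fun t => by
    change energy a lam p (dilation 0 (γ t)) = _
    rw [dilation_zero]
  obtain ⟨z, t, hz, hz1, hz2, hz3⟩ := exists_almost_critical_near_path
    (contDiff_dilatedEnergy (a := a) (lam := lam) hp2 hp6) (m := c) hε γ₀
    (by rw [hΦγ, hγ.1, energy_zero (by linarith)]; exact hc)
    (by rw [hΦγ]; exact hγ.2.trans hc)
    (by
      intro η h0 h1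
      let γ' : C(unitInterval, H1) := ⟨fun t => dilation (η t).fst (η t).snd,
        continuous_dilation.comp ((WithLp.prod_continuous_ofLp 2 _ _).comp η.continuous)⟩
      have h0' : γ' 0 = 0 := by
        change dilation (η 0).fst (η 0).snd = 0
        rw [h0]
        change dilation 0 (γ 0) = 0
        rw [hγ.1, map_zero]
      have h1' : γ' 1 = γ 1 := by
        change dilation (η 1).fst (η 1).snd = γ 1
        rw [h1]
        exact dilation_zero _
      exact exists_mountainPassLevel_le_energy hp2 hp6 hbdd (γ := γ')
        ⟨h0', by rw [h1']; exact hγ.2⟩)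
    (fun t => by
      rw [hΦγ]
      exact (le_ciSup (bddAbove_range_energy (a := a) (lam := lam) hp2 hp6 γ) t).trans hγc.le)
  -- The reference path has `θ = 0`, so closeness to it bounds `θ`; this is where the localization
  -- of the minimax theorem enters.
  have hθ : |z.fst| ≤ ε := by
    have h1 := WithLp.prod_norm_sq_eq_of_L2 (z - γ₀ t)
    have h2 : (z - γ₀ t).fst = z.fst := by
      change z.fst - 0 = z.fst
      rw [sub_zero]
    rw [h2, Real.norm_eq_abs] at h1
    refine (abs_le_of_sq_le_sq' ?_ (norm_nonneg _)).2.trans hz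
    rw [h1]
    exact le_add_of_nonneg_right (sq_nonneg _)
  refine ⟨dilation z.fst z.snd, ?_, ?_, ?_⟩
  · have h1 : c ≤ energy a lam p (dilation z.fst z.snd) := hz1
    have h2 : energy a lam p (dilation z.fst z.snd) ≤ c + ε ^ 2 := hz2
    rw [abs_le]
    constructor <;> nlinarith
  · refine ContinuousLinearMap.opNorm_le_bound _ (by positivity) fun w => ?_
    -- An arbitrary direction `w` is reached by dilating `dilation (-θ) w`; the cost is at most
    -- `e^{2|θ|} ≤ e²`, because `|θ| ≤ ε ≤ 1`.
    have h1 := fderiv_dilatedEnergy_snd (a := a) (lam := lam) hp2 hp6 z (dilation (-z.fst) w)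
    rw [dilation_neg_dilation] at h1
    rw [← h1]
    refine (ContinuousLinearMap.le_opNorm _ _).trans ?_
    have h2 : ‖WithLp.toLp 2 ((0 : ℝ), dilation (-z.fst) w)‖ = ‖dilation (-z.fst) w‖ := by
      simp
    rw [h2, mul_assoc]
    have h3 := norm_dilation_le (-z.fst) w
    rw [abs_neg] at h3
    have h4 : 2 * |z.fst| ≤ 2 := by linarith
    calc ‖fderiv ℝ (dilatedEnergy a lam p) z‖ * ‖dilation (-z.fst) w‖
        ≤ ε * (Real.exp (2 * |z.fst|) * ‖w‖) := by gcongr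
      _ ≤ ε * (Real.exp 2 * ‖w‖) := by gcongr
  · rw [← fderiv_dilatedEnergy_fst hp2 hp6, ← Real.norm_eq_abs]
    refine (ContinuousLinearMap.le_opNorm _ _).trans ?_
    have h2 : ‖WithLp.toLp 2 ((1 : ℝ), (0 : H1))‖ = 1 := by simp
    rw [h2, mul_one]
    exact hz3

theorem tendsto_zero_of_opNorm_le {E : Type*} [NormedAddCommGroup E] [NormedSpace ℝ E]
    {f : ℕ → E →L[ℝ] ℝ} {b : ℕ → ℝ} (h : ∀ n, ‖f n‖ ≤ b n) (hb : Tendsto b atTop (𝓝 0)) :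
    Tendsto f atTop (𝓝 0) :=
  squeeze_zero_norm h hb

theorem exists_isPohozaevPalaisSmale {a lam p : ℝ} (hp2 : 2 < p) (hp6 : p ≤ 6)
    (hne : (paths a lam p).Nonempty) (hc : 0 < mountainPassLevel a lam p) :
    ∃ u : ℕ → H1, IsPohozaevPalaisSmale a lam p u := by
  let r : ℕ → ℝ := fun n => 1 / ((n : ℝ) + 1)
  have hr : ∀ n, 0 < r n := fun n => Nat.one_div_pos_of_nat
  have hr1 : ∀ n, r n ≤ 1 := fun n => by
    rw [div_le_one (by positivity)]; linarith [n.cast_nonneg (α := ℝ)]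
  have hr0 : Tendsto r atTop (𝓝 0) := tendsto_one_div_add_atTop_nhds_zero_nat
  choose u h1 h2 h3 using fun n => exists_almost_critical hp2 hp6 hne hc (hr n) (hr1 n)
  refine ⟨u, ?_, ?_, ?_⟩
  · exact tendsto_iff_norm_sub_tendsto_zero.2 (squeeze_zero (fun _ => norm_nonneg _) h1 hr0)
  · exact tendsto_zero_of_opNorm_le h2 (by simpa using hr0.mul_const (Real.exp 2))
  · exact squeeze_zero_norm h3 hr0

end SchrodingerPoisson

theorem mainTheorem4 (a lam p : ℝ) (ha : 0 < a) (hlam : 0 < lam) (hp3 : 3 < p) (hp4 : p ≤ 4) :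
    -- the derivative, the functional `G_a` and the mountain pass level are what they should be
    ContDiff ℝ 1 (energy a lam p) ∧
    (∀ u : H1, nehariPohozaev a lam p u
      = 2 * fderiv ℝ (energy a lam p) u u - pohozaev a lam p u) ∧
    (paths a lam p).Nonempty ∧
    0 < mountainPassLevel a lam p ∧
    -- existence of the sequence
    (∃ u : ℕ → H1, IsPohozaevPalaisSmale a lam p u) ∧
    -- boundedness of all such sequences
    (∀ u : ℕ → H1, IsPohozaevPalaisSmale a lam p u → ∃ C : ℝ, ∀ n, ‖u n‖ ≤ C) := by
  have hp2 : 2 < p := by linarith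
  have hp6 : p ≤ 6 := by linarith
  have hne : (paths a lam p).Nonempty := nonempty_paths ha hlam (by linarith)
  have hc := mountainPassLevel_pos ha hlam hp3 hp4 hne
  exact ⟨contDiff_energy hp2 hp6, nehariPohozaev_eq hp2 hp6, hne, hc,
    exists_isPohozaevPalaisSmale hp2 hp6 hne hc,
    fun u hu => bounded_of_tendsto ha hp3 hp4 hu.1 hu.2.2⟩
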